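/- Let $(e^{-tA})_{t\ge 0}$ be a bounded $C_0$-semigroup on a complex Banach space $X$ with generator $-A$. Suppose that the range of $A$ is dense in $X$ and that $$\{|s| : s\in\mathbb R,\ is\in\sigma(A)\}=[0,\infty).$$ For $n\in\mathbb N=\{1,2,\dots\}$ and $t>0$ put $\Delta_{n,t}(A)=(1+\tfrac tn A)^{-n}-e^{-tA}$. A Stieltjes function is a function $f:(0,\infty)\to[0,\infty)$ of the form $f(x)=a+\int_{[0,\infty)}\frac{\mu(d\tau)}{x+\tau}$ with $a\ge 0$ and a positive Radon measure $\mu$ on $[0,\infty)$ satisfying $\int_{[0,\infty)}\frac{\mu(d\tau)}{1+\tau}<\infty$; it is identified with its analytic extension to $\mathbb C\setminus(-\infty,0]$. Let $\tilde{\mathcal S}_2$ be the set of products $f_1f_2$ of two Stieltjes functions. The operators $f(A)$ are those of the extended Hille–Phillips calculus: for a finite complex Borel measure $\mu$ on $[0,\infty)$ with Laplace transform $g(z)=\int_{[0,\infty)}e^{-sz}\,\mu(ds)$ one sets $g(A)x=\int_{[0,\infty)}e^{-sA}x\,\mu(ds)$; a holomorphic function $f$ on $\{\operatorname{Re}z>0\}$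 belongs to the extended calculus if there is such a Laplace transform $e$ with $e(A)$ injective and $ef$ again such a Laplace transform, and then $f(A)=e(A)^{-1}(ef)(A)$ with domain $\{x: (ef)(A)x\in\operatorname{ran}e(A)\}$. Then every $f\in\tilde{\mathcal S}_2$ belongs to the extended calculus and, for all $n\in\mathbb N$ and $t>0$, the operator $f(A)\Delta_{n,t}(A)$ is defined and bounded on all of $X$ and $$\|f(A)\Delta_{n,t}(A)\|\ \ge\ \tfrac12\Bigl(1-\tfrac1{\sqrt2}\Bigr) f\bigl(\sqrt n/t\bigr).$$ In particular, for every $\alpha\in(0,2]$, with $A^{-\alpha}=f(A)$ for $f(z)=z^{-\alpha}$ (principal branch), the operator $A^{-\alpha}\Delta_{n,t}(A)$ is defined and bounded on all of $X$, and for all $n\in\mathbb N$ and $t>0$ $$\|A^{-\alpha}\Delta_{n,t}(A)\|\ \ge\ \tfrac12\Bigl(1-\tfrac1{\sqrt2}\Bigr)\Bigl(\frac{t}{\sqrt n}\Bigr)^{\alpha}.$$ -/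

import Mathlib

open MeasureTheory Filter Topology
open scoped NNReal

namespace EulerRates

/-- A bounded `C_0`-semigroup `(T(t))_{t ≥ 0}` on a complex normed space `X`. -/
structure BoundedC0Semigroup (X : Type*) [NormedAddCommGroup X] [NormedSpace ℂ X] where
  /-- the operators `T(t)`, `t ≥ 0` -/
  op : ℝ≥0 → X →L[ℂ] X
  map_zero : op 0 = 1
  map_add : ∀ s t, op (s + t) = op s * op t
  strongly_continuous : ∀ x, Continuous fun t => op t x
  bounded : ∃ M : ℝ, ∀ t, ‖op t‖ ≤ M

/-- A finite complex Borel measure on `[0, ∞)`, an element of `M(ℝ₊)`, presented as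
`density · base` with a finite positive measure `base` and `density ∈ L¹(base)`. By polar
decomposition every finite complex measure is of this form. -/
structure FiniteComplexMeasure where
  base : Measure ℝ≥0
  density : ℝ≥0 → ℂ
  finite : IsFiniteMeasure base
  integrable : Integrable density base

/-- The Laplace transform `(ℒμ)(z) = ∫_{[0,∞)} e^{-sz} μ(ds)`. -/
noncomputable def FiniteComplexMeasure.laplace (μ : FiniteComplexMeasure) (z : ℂ) : ℂ :=
  ∫ s : ℝ≥0, Complex.exp (-((s : ℝ) : ℂ) * z) * μ.density s ∂μ.base

section Operators

variable {X : Type*} [NormedAddCommGroup X] [NormedSpace ℂ X]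

/-- `B` is the generator of the semigroup `T`: `x ∈ dom B` and `B x = y` hold if and only if
`(T(h) x - x) / h → y` as `h → 0+`. -/
def BoundedC0Semigroup.IsGenerator (T : BoundedC0Semigroup X) (B : X →ₗ.[ℂ] X) : Prop :=
  ∀ x y : X, (x, y) ∈ B.graph ↔
    Tendsto (fun h : ℝ≥0 => ((h : ℝ)⁻¹ : ℂ) • (T.op h x - x)) (𝓝[>] 0) (𝓝 y)

/-- The operator `c + d A` with domain `dom A`. -/
def affine (A : X →ₗ.[ℂ] X) (c d : ℂ) : X →ₗ.[ℂ] X where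
  domain := A.domain
  toFun := c • A.domain.subtype + d • A.toFun

/-- The bounded operator `R`, defined on all of `X`, is the two-sided inverse of the
(possibly unbounded) operator `B`. -/
def IsBoundedInverse (B : X →ₗ.[ℂ] X) (R : X →L[ℂ] X) : Prop :=
  (∀ y : X, ∃ h : R y ∈ B.domain, B ⟨R y, h⟩ = y) ∧ ∀ x : B.domain, R (B x) = x

/-- The spectrum of an operator `A`: all `z` such that `z - A` has no bounded inverse. -/
def spectrum (A : X →ₗ.[ℂ] X) : Set ℂ :=
  {z | ¬ ∃ R : X →L[ℂ] X, IsBoundedInverse (affine A z (-1)) R}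

open Classical in
/-- The bounded inverse `B⁻¹` (which is unique if it exists; the value `0` if there is none). -/
noncomputable def boundedInverse (B : X →ₗ.[ℂ] X) : X →L[ℂ] X :=
  if h : ∃ R : X →L[ℂ] X, IsBoundedInverse B R then h.choose else 0

/-- The error `Δ_{n,t}(A) = (1 + (t/n) A)^{-n} - e^{-tA}` of Euler's approximation, where `T` is
the semigroup `(e^{-tA})_{t ≥ 0}`. -/
noncomputable def eulerError (T : BoundedC0Semigroup X) (A : X →ₗ.[ℂ] X) (n : ℕ) (t : ℝ≥0) :
    X →L[ℂ] X :=
  boundedInverse (affine A 1 (((t : ℝ) / (n : ℝ) : ℝ) : ℂ)) ^ n - T.op t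

/-- The product `P D` with its natural domain `{x | D x ∈ dom P}`, where `D` is bounded. -/
def mulBounded (P : X →ₗ.[ℂ] X) (D : X →L[ℂ] X) : X →ₗ.[ℂ] X where
  domain := P.domain.comap D.toLinearMap
  toFun := P.toFun ∘ₗ (D.toLinearMap.restrict fun _ hx => hx)

/-- The operator `P` is bounded with domain the whole space, and equals `B` there. -/
def EqBounded (P : X →ₗ.[ℂ] X) (B : X →L[ℂ] X) : Prop :=
  P = B.toLinearMap.toPMap ⊤

end Operators

section Calculus

variable {X : Type*} [NormedAddCommGroup X] [NormedSpace ℂ X]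

namespace BoundedC0Semigroup

lemma aestronglyMeasurable_orbit (T : BoundedC0Semigroup X) (μ : FiniteComplexMeasure) (x : X) :
    AEStronglyMeasurable (fun s => μ.density s • T.op s x) μ.base :=
  μ.integrable.aestronglyMeasurable.smul (T.strongly_continuous x).aestronglyMeasurable

lemma norm_orbit_le (T : BoundedC0Semigroup X) (μ : FiniteComplexMeasure) (x : X) (s : ℝ≥0) :
    ‖μ.density s • T.op s x‖ ≤ ‖μ.density s‖ * (T.bounded.choose * ‖x‖) := by
  rw [norm_smul]
  gcongr
  exact (T.op s).le_of_opNorm_le (T.bounded.choose_spec s) x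

lemma integrable_orbit (T : BoundedC0Semigroup X) (μ : FiniteComplexMeasure) (x : X) :
    Integrable (fun s => μ.density s • T.op s x) μ.base :=
  (μ.integrable.norm.mul_const (T.bounded.choose * ‖x‖)).mono'
    (T.aestronglyMeasurable_orbit μ x) (Eventually.of_forall (T.norm_orbit_le μ x))

/-- The Hille-Phillips calculus: `H(ℒμ) x = ∫_{[0,∞)} T(s) x μ(ds)`. -/
noncomputable def hillePhillips (T : BoundedC0Semigroup X) (μ : FiniteComplexMeasure) :
    X →L[ℂ] X :=
  LinearMap.mkContinuous
    { toFun := fun x => ∫ s, μ.density s • T.op s x ∂μ.base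
      map_add' := fun x y => by
        simp only [_root_.map_add, smul_add]
        exact integral_add (T.integrable_orbit μ x) (T.integrable_orbit μ y)
      map_smul' := fun c x => by
        simp only [map_smul, RingHom.id_apply]
        rw [← integral_smul]
        exact integral_congr_ae (Eventually.of_forall fun s => smul_comm _ _ _) }
    ((∫ s, ‖μ.density s‖ ∂μ.base) * T.bounded.choose)
    (fun x => by
      refine (norm_integral_le_integral_norm _).trans ?_
      rw [mul_assoc, ← integral_mul_const]
      exact integral_mono (T.integrable_orbit μ x).norm (μ.integrable.norm.mul_const _)
        (T.norm_orbit_le μ x))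

/-- `e = ℒμ` is a regularizer for `f`, with `e f = ℒν` on the open right half-plane and with
`e(A) = H(ℒμ)` injective. -/
def IsRegularizer (T : BoundedC0Semigroup X) (f : ℂ → ℂ) (μ ν : FiniteComplexMeasure) : Prop :=
  Function.Injective (T.hillePhillips μ) ∧
    ∀ z : ℂ, 0 < z.re → μ.laplace z * f z = ν.laplace z

/-- `f` is holomorphic on the open right half-plane and has a regularizer, that is, it belongs to
the extended Hille-Phillips calculus. -/
def Regularizable (T : BoundedC0Semigroup X) (f : ℂ → ℂ) : Prop :=
  DifferentiableOn ℂ f {z | 0 < z.re} ∧ ∃ μ ν, T.IsRegularizer f μ ν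

/-- The operator `U⁻¹ V` with domain `{x | V x ∈ ran U}`, for `U` injective. -/
noncomputable def invMul (U V : X →L[ℂ] X) (hU : Function.Injective U) : X →ₗ.[ℂ] X where
  domain := (LinearMap.range U.toLinearMap).comap V.toLinearMap
  toFun := (LinearEquiv.ofInjective U.toLinearMap hU).symm.toLinearMap ∘ₗ
    (V.toLinearMap.restrict fun _ hx => hx)

open Classical in
/-- The extended Hille-Phillips calculus: `f(A) = e(A)⁻¹ (e f)(A)` with domain
`{x | (e f)(A) x ∈ ran e(A)}`, where `e` is a regularizer for `f` (the operator does not depend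
on the choice of `e`). Only the values of `f` on the open right half-plane matter. The value is
irrelevant for functions that are not regularizable. -/
noncomputable def calculus (T : BoundedC0Semigroup X) (f : ℂ → ℂ) : X →ₗ.[ℂ] X :=
  if h : T.Regularizable f then
    invMul (T.hillePhillips h.2.choose) (T.hillePhillips h.2.choose_spec.choose)
      h.2.choose_spec.choose_spec.1
  else ⊥

end BoundedC0Semigroup

end Calculus

/-- Stieltjes functions, identified with their analytic extensions to `ℂ ∖ (-∞, 0]`:
`f(x) = a + ∫_{[0,∞)} μ(dτ) / (x + τ)` for `x > 0`, with `a ≥ 0` and a positive measure `μ` such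
that `∫ μ(dτ) / (1 + τ) < ∞` (which makes `μ` a Radon measure). -/
def IsStieltjes (f : ℂ → ℂ) : Prop :=
  DifferentiableOn ℂ f Complex.slitPlane ∧
    ∃ (a : ℝ) (μ : Measure ℝ≥0), 0 ≤ a ∧ Integrable (fun τ : ℝ≥0 => (1 + (τ : ℝ))⁻¹) μ ∧
      ∀ x : ℝ, 0 < x → f x = ((a + ∫ τ : ℝ≥0, (x + (τ : ℝ))⁻¹ ∂μ : ℝ) : ℂ)

/-- Products of two Stieltjes functions. -/
def IsStieltjesProduct (f : ℂ → ℂ) : Prop :=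
  ∃ f₁ f₂ : ℂ → ℂ, IsStieltjes f₁ ∧ IsStieltjes f₂ ∧
    ∀ z ∈ Complex.slitPlane, f z = f₁ z * f₂ z

end EulerRates

/-! Boundedness comes from cancellation at the origin. A Stieltjes function is singular at 0 at
worst like `1/z`, and `z/(z+1) * f z` is the Laplace transform of a finite complex measure
(`IsStieltjes.div_mul_mem_laplaceAlgebra`). Hence `(z/(z+1))^2` turns a product `f` of two of them
into a Laplace transform. It regularizes `f`, because its operator is `(A(1+A)⁻¹)²` and `A` is
injective (`injective_of_dense_range`, a mean ergodic argument). The scalar Euler error vanishes to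
second order at 0, so its product with `((z+1)/z)^2` is again a Laplace transform
(`scalarEulerError_mul_mem_laplaceAlgebra`). Multiplying, `f Δ` is a Laplace transform and
`f(A)Δ(A)` is the corresponding Hille-Phillips operator.

The lower bound is spectral inclusion. The spectrum of `A` lies in the closed right half-plane, so a
spectral point `is` is a boundary point and hence an approximate eigenvalue
(`exists_approximate_eigenvector`). On approximate eigenvectors the operator with symbol `g` acts
almost as `g(is)`, so its norm is at least `|g(is)|` (`norm_laplace_le_norm_hillePhillips`). Take
`|s| = √n/t`. There `|Δ(is)| ≥ 1 - (1+1/n)^(-n/2) ≥ 1 - 1/√2`, and each Stieltjes factor satisfies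
`|f(is)| ≥ f(|s|)/√2` (`IsStieltjes.re_le_sqrt_two_mul_norm`). The two factors together give the
constant `1/2`.

All operator identities are transferred from scalar ones through the subalgebra `calculusGraph` of
pairs (symbol, operator), which is single-valued because Laplace transforms determine measures
(`calculusGraph_unique`). -/

namespace EulerRates

/-! ### Finite complex measures on the half-line -/

namespace FiniteComplexMeasure

section Pushforward

variable {Ω : Type*} [MeasurableSpace Ω]

/-- The image under `S` of the positive measure `g⁺ · P`. -/
noncomputable def posPart (P : Measure Ω) (S : Ω → ℝ≥0) (g : Ω → ℝ) : Measure ℝ≥0 :=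
  (P.withDensity fun ω => ENNReal.ofReal (g ω)).map S

lemma isFiniteMeasure_posPart {P : Measure Ω} (S : Ω → ℝ≥0) {g : Ω → ℝ} (hg : Integrable g P) :
    IsFiniteMeasure (posPart P S g) := by
  have : IsFiniteMeasure (P.withDensity fun ω => ENNReal.ofReal (g ω)) :=
    isFiniteMeasure_withDensity_ofReal hg.2
  unfold posPart
  infer_instance

lemma integral_posPart {E : Type*} [NormedAddCommGroup E] [NormedSpace ℝ E] {P : Measure Ω}
    {S : Ω → ℝ≥0} (hS : Measurable S) {g : Ω → ℝ} (hg : Integrable g P) {φ : ℝ≥0 → E}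
    (hφ : Continuous φ) :
    ∫ s, φ s ∂(posPart P S g) = ∫ ω, max (g ω) 0 • φ (S ω) ∂P := by
  unfold posPart
  rw [integral_map hS.aemeasurable hφ.aestronglyMeasurable,
    integral_withDensity_eq_integral_toReal_smul₀ hg.aemeasurable.ennreal_ofReal
      (Eventually.of_forall fun _ => ENNReal.ofReal_lt_top)]
  simp only [ENNReal.toReal_ofReal']

/-- The part of `w` in the direction of `I ^ k`, before taking positive parts. -/
noncomputable def component (w : Ω → ℂ) (k : Fin 4) (ω : Ω) : ℝ :=
  ((-Complex.I) ^ (k : ℕ) * w ω).re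

lemma integrable_component {P : Measure Ω} {w : Ω → ℂ} (hw : Integrable w P) (k : Fin 4) :
    Integrable (component w k) P :=
  (hw.const_mul ((-Complex.I) ^ (k : ℕ))).re

-- The four components are `Re w`, `Im w`, `-Re w`, `-Im w`. Their positive parts, weighted by `1,
-- I, -1, -I`, are the Jordan decompositions of the real and imaginary parts of `w`.
omit [MeasurableSpace Ω] in
lemma sum_component (w : Ω → ℂ) (ω : Ω) :
    ∑ k : Fin 4, Complex.I ^ (k : ℕ) * ((max (component w k ω) 0 : ℝ) : ℂ) = w ω := by
  have key : ∀ a : ℝ, max a 0 - max (-a) 0 = a := fun a => by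
    rcases le_total a 0 with h | h
    · rw [max_eq_right h, max_eq_left (by linarith)]; ring
    · rw [max_eq_left h, max_eq_right (by linarith)]; ring
  have h0 : component w 0 ω = (w ω).re := by simp [component]
  have h1 : component w 1 ω = (w ω).im := by simp [component]
  have h2 : component w 2 ω = -(w ω).re := by simp [component]
  have h3 : component w 3 ω = -(w ω).im := by simp [component, pow_succ]
  have hI : Complex.I ^ 3 = -Complex.I := by simp [pow_succ]
  simp only [Fin.sum_univ_four, h0, h1, h2, h3]
  apply Complex.ext
  · simp [hI, ← sub_eq_add_neg, key]
  · simp [hI, ← sub_eq_add_neg, key]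

variable (P : Measure Ω) (S : Ω → ℝ≥0) {w : Ω → ℂ}

/-- The image under `S` of the complex measure `w · P`. -/
noncomputable def pushforward (hw : Integrable w P) : FiniteComplexMeasure where
  base := ∑ k : Fin 4, posPart P S (component w k)
  density s := ∑ k : Fin 4, Complex.I ^ (k : ℕ) *
    (((posPart P S (component w k)).rnDeriv
      (∑ k : Fin 4, posPart P S (component w k)) s).toReal : ℂ)
  finite := by
    have := fun k => isFiniteMeasure_posPart S (integrable_component hw k)
    infer_instance
  integrable := by
    have := fun k => isFiniteMeasure_posPart S (integrable_component hw k)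
    exact integrable_finsetSum _ fun k _ =>
      (Measure.integrable_toReal_rnDeriv.ofReal (𝕜 := ℂ)).const_mul _

variable {E : Type*} [NormedAddCommGroup E] [NormedSpace ℂ E]

/-- Test functions are vector-valued so that one formula serves both the kernels `e^{-sz}` and the
orbits `T(s)x`. The same holds for sums and convolutions below. -/
lemma integral_pushforward (hw : Integrable w P) (hS : Measurable S) {φ : ℝ≥0 → E}
    (hφ : Continuous φ) {C : ℝ} (hC : ∀ s, ‖φ s‖ ≤ C) :
    ∫ s, (pushforward P S hw).density s • φ s ∂(pushforward P S hw).base =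
      ∫ ω, w ω • φ (S ω) ∂P := by
  have fin := fun k => isFiniteMeasure_posPart S (integrable_component hw k)
  set m : Fin 4 → Measure ℝ≥0 := fun k => posPart P S (component w k) with hm
  have hac : ∀ k, m k ≪ ∑ k, m k := fun k =>
    (Measure.sum_fintype m ▸ Measure.le_sum m k : m k ≤ ∑ k, m k).absolutelyContinuous
  have hint : ∀ k, Integrable φ (m k) := fun k =>
    (integrable_const C).mono' hφ.aestronglyMeasurable (Eventually.of_forall hC)
  have hint' : ∀ k, Integrable (fun ω => max (component w k ω) 0 • φ (S ω)) P := fun k => by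
    have h := (integrable_component hw k).pos_part
    refine (h.norm.mul_const C).mono' (h.aestronglyMeasurable.smul
      (hφ.comp_stronglyMeasurable hS.stronglyMeasurable).aestronglyMeasurable)
      (Eventually.of_forall fun ω => ?_)
    rw [norm_smul]
    exact mul_le_mul_of_nonneg_left (hC _) (norm_nonneg _)
  calc ∫ s, (pushforward P S hw).density s • φ s ∂(pushforward P S hw).base
      = ∫ s, ∑ k : Fin 4, Complex.I ^ (k : ℕ) • (((m k).rnDeriv (∑ k, m k) s).toReal • φ s)
          ∂(∑ k, m k) := by
        refine integral_congr_ae (Eventually.of_forall fun s => ?_)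
        simp only [pushforward, Finset.sum_smul, mul_smul, hm, Complex.coe_smul]
    _ = ∑ k : Fin 4, Complex.I ^ (k : ℕ) • ∫ s, φ s ∂(m k) := by
        rw [integral_finsetSum]
        · simp only [integral_smul, integral_rnDeriv_smul (hac _)]
        · intro k _
          exact ((integrable_rnDeriv_smul_iff (hac k)).2 (hint k)).smul _
    _ = ∫ ω, ∑ k : Fin 4, Complex.I ^ (k : ℕ) • (max (component w k ω) 0 • φ (S ω)) ∂P := by
        rw [integral_finsetSum]
        · simp only [integral_smul, hm, integral_posPart hS (integrable_component hw _) hφ]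
        · exact fun k _ => (hint' k).smul _
    _ = ∫ ω, w ω • φ (S ω) ∂P := by
        refine integral_congr_ae (Eventually.of_forall fun ω => ?_)
        simp only
        conv_rhs => rw [← sum_component w ω, Finset.sum_smul]
        simp only [mul_smul, Complex.coe_smul]

end Pushforward

/-- The sum of two finite complex measures. -/
noncomputable def add (μ ν : FiniteComplexMeasure) : FiniteComplexMeasure where
  base := μ.base + ν.base
  density s := (μ.base.rnDeriv (μ.base + ν.base) s).toReal • μ.density s +
    (ν.base.rnDeriv (μ.base + ν.base) s).toReal • ν.density s
  finite := by
    have := μ.finite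
    have := ν.finite
    infer_instance
  integrable := by
    have := μ.finite
    have := ν.finite
    exact ((integrable_rnDeriv_smul_iff (Measure.AbsolutelyContinuous.rfl.add_right _)).2
      μ.integrable).add ((integrable_rnDeriv_smul_iff
        (Measure.le_add_left le_rfl).absolutelyContinuous).2
      ν.integrable)

variable {E : Type*} [NormedAddCommGroup E] [NormedSpace ℂ E]

lemma integrable_smul (μ : FiniteComplexMeasure) {φ : ℝ≥0 → E} (hφ : Continuous φ) {C : ℝ}
    (hC : ∀ s, ‖φ s‖ ≤ C) : Integrable (fun s => μ.density s • φ s) μ.base :=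
  (μ.integrable.norm.mul_const C).mono'
    (μ.integrable.aestronglyMeasurable.smul hφ.aestronglyMeasurable)
    (Eventually.of_forall fun s => by
      rw [norm_smul]
      exact mul_le_mul_of_nonneg_left (hC _) (norm_nonneg _))

lemma integral_add (μ ν : FiniteComplexMeasure) {φ : ℝ≥0 → E} (hφ : Continuous φ) {C : ℝ}
    (hC : ∀ s, ‖φ s‖ ≤ C) :
    ∫ s, (μ.add ν).density s • φ s ∂(μ.add ν).base =
      ∫ s, μ.density s • φ s ∂μ.base + ∫ s, ν.density s • φ s ∂ν.base := by
  have := μ.finite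
  have := ν.finite
  have h1 : μ.base ≪ μ.base + ν.base := Measure.AbsolutelyContinuous.rfl.add_right _
  have h2 : ν.base ≪ μ.base + ν.base := (Measure.le_add_left le_rfl).absolutelyContinuous
  simp only [add, add_smul, smul_assoc]
  rw [MeasureTheory.integral_add, integral_rnDeriv_smul h1, integral_rnDeriv_smul h2]
  · exact (integrable_rnDeriv_smul_iff h1).2 (μ.integrable_smul hφ hC)
  · exact (integrable_rnDeriv_smul_iff h2).2 (ν.integrable_smul hφ hC)

/-- The convolution of two finite complex measures. -/
noncomputable def conv (μ ν : FiniteComplexMeasure) : FiniteComplexMeasure :=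
  haveI := μ.finite
  haveI := ν.finite
  pushforward (μ.base.prod ν.base) (fun p => p.1 + p.2) (μ.integrable.mul_prod ν.integrable)

lemma integral_conv (μ ν : FiniteComplexMeasure) {φ : ℝ≥0 → E} (hφ : Continuous φ) {C : ℝ}
    (hC : ∀ s, ‖φ s‖ ≤ C) :
    ∫ s, (μ.conv ν).density s • φ s ∂(μ.conv ν).base =
      ∫ s, μ.density s • ∫ u, ν.density u • φ (s + u) ∂ν.base ∂μ.base := by
  have := μ.finite
  have := ν.finite
  have hw := μ.integrable.mul_prod ν.integrable
  rw [conv, integral_pushforward _ _ hw (by fun_prop) hφ hC, integral_prod]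
  · simp only [mul_smul, integral_smul]
  · have hc : Continuous fun p : ℝ≥0 × ℝ≥0 => φ (p.1 + p.2) := by fun_prop
    refine (hw.norm.mul_const C).mono' (hw.aestronglyMeasurable.smul hc.aestronglyMeasurable)
      (Eventually.of_forall fun p => ?_)
    rw [norm_smul]
    exact mul_le_mul_of_nonneg_left (hC _) (norm_nonneg _)

/-! ### Algebraic and analytic properties of Laplace transforms -/

lemma continuous_laplaceKernel (z : ℂ) :
    Continuous fun s : ℝ≥0 => Complex.exp (-((s : ℝ) : ℂ) * z) := by
  fun_prop

lemma norm_laplaceKernel_le {z : ℂ} (hz : 0 ≤ z.re) (s : ℝ≥0) :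
    ‖Complex.exp (-((s : ℝ) : ℂ) * z)‖ ≤ 1 := by
  rw [Complex.norm_exp, Real.exp_le_one_iff]
  simpa using mul_nonneg s.2 hz

lemma laplace_eq (μ : FiniteComplexMeasure) (z : ℂ) :
    μ.laplace z = ∫ s, μ.density s • Complex.exp (-((s : ℝ) : ℂ) * z) ∂μ.base := by
  simp only [laplace, smul_eq_mul, mul_comm]

lemma laplace_pushforward {Ω : Type*} [MeasurableSpace Ω] (P : Measure Ω) {S : Ω → ℝ≥0}
    (hS : Measurable S) {w : Ω → ℂ} (hw : Integrable w P) {z : ℂ} (hz : 0 ≤ z.re) :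
    (pushforward P S hw).laplace z = ∫ ω, w ω * Complex.exp (-((S ω : ℝ) : ℂ) * z) ∂P := by
  rw [laplace_eq, integral_pushforward P S hw hS (continuous_laplaceKernel z)
    (norm_laplaceKernel_le hz)]
  rfl

lemma laplace_add (μ ν : FiniteComplexMeasure) {z : ℂ} (hz : 0 ≤ z.re) :
    (μ.add ν).laplace z = μ.laplace z + ν.laplace z := by
  simp only [laplace_eq]
  exact integral_add μ ν (continuous_laplaceKernel z) (norm_laplaceKernel_le hz)

lemma laplace_conv (μ ν : FiniteComplexMeasure) {z : ℂ} (hz : 0 ≤ z.re) :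
    (μ.conv ν).laplace z = μ.laplace z * ν.laplace z := by
  simp only [laplace_eq]
  rw [integral_conv μ ν (continuous_laplaceKernel z) (norm_laplaceKernel_le hz),
    ← integral_mul_const]
  refine integral_congr_ae (Eventually.of_forall fun s => ?_)
  simp only [smul_eq_mul, mul_assoc]
  congr 1
  rw [← integral_const_mul]
  refine integral_congr_ae (Eventually.of_forall fun u => ?_)
  simp only
  rw [mul_left_comm, ← Complex.exp_add]
  push_cast
  ring_nf

/-- The closed half-plane matters: both uniqueness and spectral inclusion evaluate the transform on
the imaginary axis. -/
lemma continuousOn_laplace (μ : FiniteComplexMeasure) :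
    ContinuousOn μ.laplace {z | 0 ≤ z.re} := by
  have : μ.laplace = fun z => ∫ s, μ.density s • Complex.exp (-((s : ℝ) : ℂ) * z) ∂μ.base :=
    funext μ.laplace_eq
  rw [this]
  refine continuousOn_of_dominated (bound := fun s => ‖μ.density s‖) ?_ ?_ μ.integrable.norm ?_
  · exact fun z _ => μ.integrable.aestronglyMeasurable.smul
      (continuous_laplaceKernel z).aestronglyMeasurable
  · refine fun z hz => Eventually.of_forall fun s => ?_
    rw [norm_smul]
    exact mul_le_of_le_one_right (norm_nonneg _) (norm_laplaceKernel_le hz s)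
  · exact Eventually.of_forall fun s => by fun_prop

lemma differentiableOn_laplace (μ : FiniteComplexMeasure) :
    DifferentiableOn ℂ μ.laplace {z | 0 < z.re} := by
  intro z₀ hz₀
  have hz₀ : 0 < z₀.re := hz₀
  have : μ.laplace = fun z => ∫ s, μ.density s * Complex.exp (-((s : ℝ) : ℂ) * z) ∂μ.base :=
    funext μ.laplace_eq
  rw [this]
  set δ := z₀.re / 2 with hδ
  have hδ0 : 0 < δ := by positivity
  have hmem : {z : ℂ | δ < z.re} ∈ 𝓝 z₀ :=
    (isOpen_lt continuous_const Complex.continuous_re).mem_nhds (by simp [hδ, hz₀])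
  have h := hasDerivAt_integral_of_dominated_loc_of_deriv_le (μ := μ.base)
    (F := fun z s => μ.density s * Complex.exp (-((s : ℝ) : ℂ) * z))
    (F' := fun z s => μ.density s * (Complex.exp (-((s : ℝ) : ℂ) * z) * -((s : ℝ) : ℂ)))
    (bound := fun s => ‖μ.density s‖ * δ⁻¹) hmem
    (Eventually.of_forall fun z => μ.integrable.aestronglyMeasurable.mul
      (continuous_laplaceKernel z).aestronglyMeasurable)
    (μ.integrable_smul (continuous_laplaceKernel z₀) (norm_laplaceKernel_le hz₀.le))
    (μ.integrable.aestronglyMeasurable.mul (Continuous.aestronglyMeasurable (by fun_prop)))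
    (Eventually.of_forall fun s z hz => ?_) (μ.integrable.norm.mul_const _)
    (Eventually.of_forall fun s z _ => ?_)
  · exact h.2.differentiableAt.differentiableWithinAt
  · rw [norm_mul, norm_mul]
    refine mul_le_mul_of_nonneg_left ?_ (norm_nonneg _)
    have hz : δ < z.re := hz
    have h1 : ‖Complex.exp (-((s : ℝ) : ℂ) * z)‖ ≤ Real.exp (-(s * δ)) := by
      rw [Complex.norm_exp]
      apply Real.exp_le_exp.2
      simpa using mul_le_mul_of_nonneg_left hz.le s.2
    have h2 : ‖-((s : ℝ) : ℂ)‖ = s := by simp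
    rw [h2]
    -- The inequality `y e^{-y} ≤ 1` at `y = sδ` absorbs the factor `s`, so no first moment of the
    -- measure is needed.
    calc _ ≤ Real.exp (-(s * δ)) * s := by gcongr
      _ = (Real.exp (-(s * δ)) * (s * δ)) * δ⁻¹ := by field_simp
      _ ≤ 1 * δ⁻¹ := by
        gcongr
        rw [Real.exp_neg, inv_mul_le_one₀ (Real.exp_pos _)]
        linarith [Real.add_one_le_exp ((s : ℝ) * δ)]
      _ = δ⁻¹ := one_mul _
  · have := ((hasDerivAt_id z).const_mul (-((s : ℝ) : ℂ))).cexp.const_mul (μ.density s)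
    simpa using this

end FiniteComplexMeasure

/-! ### Uniqueness of Laplace transforms -/

namespace FiniteComplexMeasure

variable {E : Type*} [NormedAddCommGroup E] [NormedSpace ℂ E]

lemma laplace_eq_zero_of_re_nonneg {μ : FiniteComplexMeasure}
    (h : ∀ z : ℂ, 0 < z.re → μ.laplace z = 0) {z : ℂ} (hz : 0 ≤ z.re) : μ.laplace z = 0 := by
  have hmem : ∀ᶠ ε : ℝ in 𝓝[>] 0, 0 < (z + ε).re := by
    filter_upwards [self_mem_nhdsWithin] with ε hε
    simpa using add_pos_of_nonneg_of_pos hz hε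
  have hlim : Tendsto (fun ε : ℝ => z + ε) (𝓝[>] 0) (𝓝[{z | 0 ≤ z.re}] z) := by
    refine tendsto_nhdsWithin_iff.2 ⟨?_, hmem.mono fun ε hε => hε.le⟩
    have : Continuous fun ε : ℝ => z + ε := by fun_prop
    simpa using (this.tendsto 0).mono_left nhdsWithin_le_nhds
  have h1 := (μ.continuousOn_laplace z hz).tendsto.comp hlim
  refine tendsto_nhds_unique h1 (tendsto_const_nhds.congr' ?_)
  filter_upwards [hmem] with ε hε
  exact (h _ hε).symm

lemma integral_smul_eq_sub_posPart {F : Type*} [NormedAddCommGroup F] [NormedSpace ℝ F]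
    {P : Measure ℝ≥0} {ρ : ℝ≥0 → ℝ} (hρ : Integrable ρ P) {φ : ℝ≥0 → F} (hφ : Continuous φ) {C : ℝ}
    (hC : ∀ s, ‖φ s‖ ≤ C) :
    ∫ s, ρ s • φ s ∂P = ∫ s, φ s ∂(posPart P id ρ) - ∫ s, φ s ∂(posPart P id (-ρ)) := by
  have hint : ∀ {g : ℝ≥0 → ℝ}, Integrable g P →
      Integrable (fun s => max (g s) 0 • φ s) P := fun {g} hg =>
    (hg.pos_part.norm.mul_const C).mono'
      (hg.pos_part.aestronglyMeasurable.smul hφ.aestronglyMeasurable)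
      (Eventually.of_forall fun s => by
        rw [norm_smul]
        exact mul_le_mul_of_nonneg_left (hC _) (norm_nonneg _))
  rw [integral_posPart measurable_id hρ hφ, integral_posPart measurable_id hρ.neg hφ]
  simp only [id]
  rw [← integral_sub (hint hρ) (hint hρ.neg)]
  refine integral_congr_ae (Eventually.of_forall fun s => ?_)
  simp only [Pi.neg_apply, ← sub_smul]
  congr 1
  rcases le_total (ρ s) 0 with h | h
  · rw [max_eq_right h, max_eq_left (by linarith)]; ring
  · rw [max_eq_left h, max_eq_right (by linarith)]; ring

/-- On the imaginary axis the transform is a characteristic function. Its vanishing says that `ρ⁺P`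
and `ρ⁻P` have equal characteristic functions, hence coincide. -/
lemma integral_real_smul_eq_zero {P : Measure ℝ≥0} {ρ : ℝ≥0 → ℝ} (hρ : Integrable ρ P)
    (h : ∀ t : ℝ, ∫ s, (ρ s : ℂ) * Complex.exp (-((s : ℝ) : ℂ) * (t * Complex.I)) ∂P = 0)
    {φ : ℝ≥0 → E} (hφ : Continuous φ) {C : ℝ} (hC : ∀ s, ‖φ s‖ ≤ C) :
    ∫ s, ρ s • φ s ∂P = 0 := by
  have f1 := isFiniteMeasure_posPart id hρ
  have f2 := isFiniteMeasure_posPart id hρ.neg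
  have hmeas : Measurable ((↑) : ℝ≥0 → ℝ) := by fun_prop
  have heq : (posPart P id ρ).map ((↑) : ℝ≥0 → ℝ) =
      (posPart P id (-ρ)).map ((↑) : ℝ≥0 → ℝ) := by
    refine Measure.ext_of_charFun (funext fun t => ?_)
    rw [charFun_apply_real, charFun_apply_real,
      integral_map hmeas.aemeasurable (Continuous.aestronglyMeasurable (by fun_prop)),
      integral_map hmeas.aemeasurable (Continuous.aestronglyMeasurable (by fun_prop)),
      ← sub_eq_zero, ← integral_smul_eq_sub_posPart hρ (C := 1) (by fun_prop) (fun s => ?_)]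
    · rw [← h (-t)]
      refine integral_congr_ae (Eventually.of_forall fun s => ?_)
      simp only [Complex.real_smul]
      congr 2
      push_cast
      ring
    · rw [Complex.norm_exp]
      simp
  have hφ' : Continuous fun x : ℝ => φ x.toNNReal := by fun_prop
  have hback : ∀ m : Measure ℝ≥0,
      ∫ s, φ s ∂m = ∫ x, φ x.toNNReal ∂(m.map ((↑) : ℝ≥0 → ℝ)) := fun m => by
    rw [integral_map hmeas.aemeasurable hφ'.aestronglyMeasurable]
    simp
  rw [integral_smul_eq_sub_posPart hρ hφ hC, hback, hback (posPart P id (-ρ)), heq, sub_self]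

lemma integral_smul_eq_zero {μ : FiniteComplexMeasure}
    (h : ∀ z : ℂ, 0 < z.re → μ.laplace z = 0) {φ : ℝ≥0 → E} (hφ : Continuous φ) {C : ℝ}
    (hC : ∀ s, ‖φ s‖ ≤ C) : ∫ s, μ.density s • φ s ∂μ.base = 0 := by
  set e : ℝ → ℝ≥0 → ℂ := fun t s => Complex.exp (-((s : ℝ) : ℂ) * (t * Complex.I)) with he
  have hec : ∀ t, Continuous (e t) := fun t => continuous_laplaceKernel _
  have hen : ∀ t s, ‖e t s‖ ≤ 1 := fun t s => norm_laplaceKernel_le (by simp) s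
  have h0 : ∀ t, ∫ s, μ.density s * e t s ∂μ.base = 0 := fun t => by
    have := laplace_eq_zero_of_re_nonneg h (z := t * Complex.I) (by simp)
    rw [laplace_eq] at this
    exact this
  -- Conjugation reflects the imaginary axis, so the conjugate density also has zero transform
  -- there. Half the sum and the difference over `2i` then reduce to real densities.
  have h1 : ∀ t, ∫ s, (starRingEnd ℂ) (μ.density s) * e t s ∂μ.base = 0 := fun t => by
    have := congrArg (starRingEnd ℂ) (h0 (-t))
    rw [← integral_conj, map_zero] at this
    rw [← this]
    refine integral_congr_ae (Eventually.of_forall fun s => ?_)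
    simp [he, ← Complex.exp_conj]
  have hi0 : ∀ t, Integrable (fun s => μ.density s * e t s) μ.base := fun t =>
    μ.integrable_smul (hec t) (hen t)
  have hi1 : ∀ t, Integrable (fun s => (starRingEnd ℂ) (μ.density s) * e t s) μ.base := fun t => by
    refine μ.integrable.norm.mono' (((Complex.continuous_conj.comp_aestronglyMeasurable
      μ.integrable.aestronglyMeasurable)).mul (hec t).aestronglyMeasurable)
      (Eventually.of_forall fun s => ?_)
    rw [norm_mul, RCLike.norm_conj]
    exact mul_le_of_le_one_right (norm_nonneg _) (hen t s)
  have hre : ∫ s, (μ.density s).re • φ s ∂μ.base = 0 := by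
    refine integral_real_smul_eq_zero μ.integrable.re (fun t => ?_) hφ hC
    have := congrArg (fun x => (1 / 2 : ℂ) * x)
      ((MeasureTheory.integral_add (hi0 t) (hi1 t)).trans (by rw [h0, h1, add_zero]))
    simp only [mul_zero, ← integral_const_mul] at this
    rw [← this]
    refine integral_congr_ae (Eventually.of_forall fun s => ?_)
    simp only [← add_mul, Complex.add_conj, he, RCLike.re_to_complex]
    push_cast
    ring
  have him : ∫ s, (μ.density s).im • φ s ∂μ.base = 0 := by
    refine integral_real_smul_eq_zero μ.integrable.im (fun t => ?_) hφ hC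
    have := congrArg (fun x => (1 / (2 * Complex.I) : ℂ) * x)
      ((MeasureTheory.integral_sub (hi0 t) (hi1 t)).trans (by rw [h0, h1, sub_zero]))
    simp only [mul_zero, ← integral_const_mul] at this
    rw [← this]
    refine integral_congr_ae (Eventually.of_forall fun s => ?_)
    simp only [← sub_mul, Complex.sub_conj, he, RCLike.im_to_complex]
    field_simp
    push_cast
    ring
  have hsplit : ∀ s, μ.density s • φ s =
      (μ.density s).re • φ s + Complex.I • ((μ.density s).im • φ s) := fun s => by
    conv_lhs => rw [← Complex.re_add_im (μ.density s), add_smul, mul_comm, mul_smul]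
    simp only [Complex.coe_smul]
  have hir : ∀ {g : ℝ≥0 → ℝ}, Integrable g μ.base →
      Integrable (fun s => g s • φ s) μ.base := fun {g} hg =>
    (hg.norm.mul_const C).mono' (hg.aestronglyMeasurable.smul hφ.aestronglyMeasurable)
      (Eventually.of_forall fun s => by
        rw [norm_smul]
        exact mul_le_mul_of_nonneg_left (hC _) (norm_nonneg _))
  calc ∫ s, μ.density s • φ s ∂μ.base
      = ∫ s, (μ.density s).re • φ s ∂μ.base +
        ∫ s, Complex.I • ((μ.density s).im • φ s) ∂μ.base := by
        simp only [hsplit]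
        exact MeasureTheory.integral_add (hir μ.integrable.re) ((hir μ.integrable.im).smul _)
    _ = 0 := by rw [integral_smul, hre, him, smul_zero, add_zero]

end FiniteComplexMeasure

/-! ### The Hille-Phillips calculus -/

section Calculus

variable {X : Type*} [NormedAddCommGroup X] [NormedSpace ℂ X]

namespace BoundedC0Semigroup

variable (T : BoundedC0Semigroup X)

/-- A bound for the semigroup. -/
noncomputable def bound : ℝ := T.bounded.choose

lemma norm_op_le (t : ℝ≥0) : ‖T.op t‖ ≤ T.bound := T.bounded.choose_spec t

lemma bound_nonneg : 0 ≤ T.bound := (norm_nonneg _).trans (T.norm_op_le 0)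

lemma norm_op_apply_le (t : ℝ≥0) (x : X) : ‖T.op t x‖ ≤ T.bound * ‖x‖ :=
  (T.op t).le_of_opNorm_le (T.norm_op_le t) x

lemma hillePhillips_apply (μ : FiniteComplexMeasure) (x : X) :
    T.hillePhillips μ x = ∫ s, μ.density s • T.op s x ∂μ.base := rfl

lemma hillePhillips_pushforward {Ω : Type*} [MeasurableSpace Ω] (P : Measure Ω) {S : Ω → ℝ≥0}
    (hS : Measurable S) {w : Ω → ℂ} (hw : Integrable w P) (x : X) :
    T.hillePhillips (.pushforward P S hw) x = ∫ ω, w ω • T.op (S ω) x ∂P :=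
  FiniteComplexMeasure.integral_pushforward P S hw hS (T.strongly_continuous x)
    fun s => T.norm_op_apply_le s x

/-- The graph of the Hille-Phillips calculus, as a subalgebra. -/
noncomputable def calculusGraph [CompleteSpace X] :
    Subalgebra ℂ (({z : ℂ // 0 < z.re} → ℂ) × (X →L[ℂ] X)) where
  carrier := {p | ∃ μ : FiniteComplexMeasure, (∀ z : {z : ℂ // 0 < z.re}, μ.laplace z = p.1 z) ∧
    T.hillePhillips μ = p.2}
  mul_mem' := by
    rintro p q ⟨μ, hμ, hp⟩ ⟨ν, hν, hq⟩
    refine ⟨μ.conv ν, fun z => ?_, ?_⟩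
    · rw [μ.laplace_conv ν z.2.le, hμ, hν]
      rfl
    · ext x
      rw [Prod.snd_mul, ← hp, ← hq, mul_apply_eq_comp, hillePhillips_apply,
        μ.integral_conv ν (T.strongly_continuous x) fun s => T.norm_op_apply_le s x,
        hillePhillips_apply]
      refine integral_congr_ae (Eventually.of_forall fun s => ?_)
      simp only [T.map_add, mul_apply_eq_comp]
      rw [hillePhillips_apply, ← ContinuousLinearMap.integral_comp_comm _ (T.integrable_orbit ν x)]
      simp only [map_smul]
  add_mem' := by
    rintro p q ⟨μ, hμ, hp⟩ ⟨ν, hν, hq⟩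
    refine ⟨μ.add ν, fun z => ?_, ?_⟩
    · rw [μ.laplace_add ν z.2.le, hμ, hν]
      rfl
    · ext x
      rw [Prod.snd_add, ← hp, ← hq]
      exact μ.integral_add ν (T.strongly_continuous x) fun s => T.norm_op_apply_le s x
  algebraMap_mem' := by
    intro c
    -- A scalar `c` is represented by the point mass `c δ₀`.
    have hw : Integrable (fun _ : Unit => c) (Measure.dirac ()) := integrable_const c
    refine ⟨.pushforward (Measure.dirac ()) (fun _ => 0) hw, fun z => ?_, ?_⟩
    · rw [FiniteComplexMeasure.laplace_pushforward _ measurable_const hw z.2.le]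
      simp
    · ext x
      rw [T.hillePhillips_pushforward _ measurable_const hw]
      simp [T.map_zero]

variable [CompleteSpace X]

/-- The difference `G - G'` comes from a measure with zero Laplace transform, which annihilates
every orbit. This is what lets scalar identities imply operator identities. -/
lemma calculusGraph_unique {g : {z : ℂ // 0 < z.re} → ℂ} {G G' : X →L[ℂ] X}
    (h : (g, G) ∈ T.calculusGraph) (h' : (g, G') ∈ T.calculusGraph) : G = G' := by
  obtain ⟨μ, hμ, hG⟩ := T.calculusGraph.sub_mem h h'
  have hμ : ∀ z : ℂ, 0 < z.re → μ.laplace z = 0 := fun z hz => by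
    simpa using hμ ⟨z, hz⟩
  rw [← sub_eq_zero]
  change T.hillePhillips μ = G - G' at hG
  rw [← hG]
  ext x
  exact FiniteComplexMeasure.integral_smul_eq_zero hμ (T.strongly_continuous x)
    fun s => T.norm_op_apply_le s x

lemma pushforward_mem_calculusGraph {Ω : Type*} [MeasurableSpace Ω] (P : Measure Ω) {S : Ω → ℝ≥0}
    (hS : Measurable S) {w : Ω → ℂ} (hw : Integrable w P) {g : {z : ℂ // 0 < z.re} → ℂ}
    (hg : ∀ z : {z : ℂ // 0 < z.re}, ∫ ω, w ω * Complex.exp (-((S ω : ℝ) : ℂ) * z) ∂P = g z) :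
    (g, T.hillePhillips (.pushforward P S hw)) ∈ T.calculusGraph :=
  ⟨_, fun z => by rw [FiniteComplexMeasure.laplace_pushforward P hS hw z.2.le, hg], rfl⟩

lemma op_mem_calculusGraph (t : ℝ≥0) :
    ((fun z => Complex.exp (-((t : ℝ) : ℂ) * z), T.op t) :
      ({z : ℂ // 0 < z.re} → ℂ) × (X →L[ℂ] X)) ∈ T.calculusGraph := by
  have hw : Integrable (fun _ : Unit => (1 : ℂ)) (Measure.dirac ()) := integrable_const 1
  refine ⟨.pushforward (Measure.dirac ()) (fun _ => t) hw, fun z => ?_, ?_⟩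
  · rw [FiniteComplexMeasure.laplace_pushforward _ measurable_const hw z.2.le]
    simp
  · ext x
    rw [T.hillePhillips_pushforward _ measurable_const hw]
    simp

end BoundedC0Semigroup

end Calculus

/-! ### The generator and its resolvent -/

section Generator

variable {X : Type*} [NormedAddCommGroup X] [NormedSpace ℂ X]

lemma IsBoundedInverse.unique {B : X →ₗ.[ℂ] X} {R R' : X →L[ℂ] X} (h : IsBoundedInverse B R)
    (h' : IsBoundedInverse B R') : R = R' := by
  ext y
  obtain ⟨hy, hBy⟩ := h'.1 y
  have := h.2 ⟨R' y, hy⟩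
  rwa [hBy] at this

lemma boundedInverse_eq {B : X →ₗ.[ℂ] X} {R : X →L[ℂ] X} (h : IsBoundedInverse B R) :
    boundedInverse B = R := by
  have hex : ∃ R : X →L[ℂ] X, IsBoundedInverse B R := ⟨R, h⟩
  rw [boundedInverse, dif_pos hex]
  exact hex.choose_spec.unique h

lemma isBoundedInverse_affine_iff {A : X →ₗ.[ℂ] X} {c d : ℂ} {R : X →L[ℂ] X} :
    IsBoundedInverse (affine A c d) R ↔
      (∀ y, ∃ h : R y ∈ A.domain, c • R y + d • A ⟨R y, h⟩ = y) ∧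
        ∀ x : A.domain, R (c • (x : X) + d • A x) = x := Iff.rfl

namespace BoundedC0Semigroup

variable {T : BoundedC0Semigroup X} {A : X →ₗ.[ℂ] X}

lemma continuous_orbit (T : BoundedC0Semigroup X) (x : X) :
    Continuous fun s : ℝ => T.op s.toNNReal x :=
  (T.strongly_continuous x).comp continuous_real_toNNReal

lemma isGenerator_neg_iff (hA : T.IsGenerator (-A)) (x y : X) :
    (∃ h : x ∈ A.domain, A ⟨x, h⟩ = -y) ↔
      Tendsto (fun h : ℝ≥0 => ((h : ℝ)⁻¹ : ℂ) • (T.op h x - x)) (𝓝[>] 0) (𝓝 y) := by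
  rw [← hA x y, LinearPMap.mem_graph_iff]
  constructor
  · rintro ⟨h, hy⟩
    exact ⟨⟨x, h⟩, rfl, by rw [LinearPMap.neg_apply]; exact (congrArg Neg.neg hy).trans (neg_neg y)⟩
  · rintro ⟨⟨u, hu⟩, rfl, hy⟩
    exact ⟨hu, (neg_neg _).symm.trans (congrArg Neg.neg hy)⟩

lemma tendsto_coe_nhdsGT_zero :
    Tendsto ((↑) : ℝ≥0 → ℝ) (𝓝[>] 0) (𝓝[>] 0) := by
  refine tendsto_nhdsWithin_iff.2 ⟨?_, ?_⟩
  · exact (NNReal.continuous_coe.tendsto 0).mono_left nhdsWithin_le_nhds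
  · filter_upwards [self_mem_nhdsWithin] with h hh
    exact NNReal.coe_pos.2 hh

lemma tendsto_of_hasDerivAt {x y : X} {F : ℝ → X} (hF : HasDerivAt F y 0)
    (h : ∀ s : ℝ≥0, F s = T.op s x) :
    Tendsto (fun h : ℝ≥0 => ((h : ℝ)⁻¹ : ℂ) • (T.op h x - x)) (𝓝[>] 0) (𝓝 y) := by
  have h1 := (hasDerivWithinAt_iff_tendsto_slope' (by simp)).1
    (hF.hasDerivWithinAt (s := Set.Ioi 0))
  refine (h1.comp tendsto_coe_nhdsGT_zero).congr fun s => ?_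
  have h0 : F 0 = x := by simpa [T.map_zero] using h 0
  simp only [Function.comp_apply, slope_def_module, h, h0, sub_zero]
  rw [← Complex.ofReal_inv, Complex.coe_smul]

/-- From `T(w)x - T(v)x = T(v)(T(w-v)x - x)`. A right derivative is all that the mean value
inequality below requires. -/
lemma hasDerivWithinAt_orbit (hA : T.IsGenerator (-A)) (x : A.domain) (v : ℝ≥0) :
    HasDerivWithinAt (fun s : ℝ => T.op s.toNNReal x) (T.op v (-A x)) (Set.Ici v) v := by
  have h := (isGenerator_neg_iff hA x (-A x)).1 ⟨x.2, (neg_neg _).symm⟩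
  rw [← hasDerivWithinAt_Ioi_iff_Ici, hasDerivWithinAt_iff_tendsto_slope' (by simp)]
  have hlim : Tendsto (fun w : ℝ => (w - v).toNNReal) (𝓝[>] (v : ℝ)) (𝓝[>] 0) := by
    refine tendsto_nhdsWithin_iff.2 ⟨?_, ?_⟩
    · have : Continuous fun w : ℝ => (w - v).toNNReal := by fun_prop
      simpa using (this.tendsto v).mono_left (nhdsWithin_le_nhds (s := Set.Ioi (v : ℝ)))
    · filter_upwards [self_mem_nhdsWithin] with w hw
      simpa using hw
  refine (((T.op v).continuous.tendsto _).comp (h.comp hlim)).congr' ?_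
  filter_upwards [self_mem_nhdsWithin] with w hw
  have hw : (v : ℝ) < w := hw
  have hadd : w.toNNReal = v + (w - v).toNNReal := by
    rw [← NNReal.coe_inj]
    push_cast
    rw [Real.coe_toNNReal _ (v.2.trans hw.le), Real.coe_toNNReal _ (sub_nonneg.2 hw.le)]
    ring
  simp only [Function.comp_apply, slope_def_module, Real.toNNReal_coe, hadd, T.map_add,
    mul_apply_eq_comp]
  rw [Real.coe_toNNReal _ (sub_nonneg.2 hw.le), map_smul, map_sub, ← Complex.ofReal_inv,
    Complex.coe_smul]

/-- On an approximate eigenvector, the semigroup acts almost as a scalar. -/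
lemma norm_op_sub_exp_le (hA : T.IsGenerator (-A)) (x : A.domain) (s : ℝ) (u : ℝ≥0) :
    ‖T.op u x - Complex.exp (-((u : ℝ) : ℂ) * (Complex.I * s)) • (x : X)‖ ≤
      T.bound * ‖(Complex.I * s) • (x : X) - A x‖ * u := by
  set z : ℂ := Complex.I * s with hz
  have hnorm : ∀ v : ℝ, ‖Complex.exp (v * z)‖ = 1 := fun v => by
    rw [Complex.norm_exp]
    simp [hz]
  -- Undoing the expected rotation gives `v ↦ e^{vz}T(v)x`, whose right derivative `e^{vz}T(v)(zx -
  -- Ax)` is bounded by the defect times the semigroup bound, since `|e^{vz}| = 1`.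
  have key := norm_image_sub_le_of_norm_deriv_right_le_segment (a := 0) (b := u)
    (f := fun v : ℝ => Complex.exp (v * z) • T.op v.toNNReal x)
    (f' := fun v : ℝ => Complex.exp (v * z) • T.op v.toNNReal (z • (x : X) - A x))
    (C := T.bound * ‖z • (x : X) - A x‖) ?_ ?_ ?_ u ⟨u.2, le_rfl⟩
  · simp only [Real.toNNReal_coe, Complex.ofReal_zero, zero_mul, Complex.exp_zero,
      Real.toNNReal_zero, T.map_zero, one_smul, sub_zero, one_apply_eq_self] at key
    refine le_trans (le_of_eq ?_) key
    have : Complex.exp (((u : ℝ) : ℂ) * z) •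
        (T.op u x - Complex.exp (-((u : ℝ) : ℂ) * z) • (x : X)) =
        Complex.exp (((u : ℝ) : ℂ) * z) • T.op u x - (x : X) := by
      rw [smul_sub, smul_smul, ← Complex.exp_add]
      simp
    rw [← this, norm_smul, hnorm, one_mul]
  · exact Continuous.continuousOn ((by fun_prop : Continuous fun v : ℝ => Complex.exp (v * z)).smul
      (T.continuous_orbit x))
  · intro v hv
    have h1 := hasDerivWithinAt_orbit hA x v.toNNReal
    rw [Real.coe_toNNReal _ hv.1] at h1
    have h2 : HasDerivAt (fun v : ℝ => Complex.exp (v * z)) (Complex.exp (v * z) * z) v := by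
      have := ((hasDerivAt_id (v : ℂ)).mul_const z).cexp.comp_ofReal
      simpa using this
    refine (h2.hasDerivWithinAt.smul h1).congr_deriv ?_
    simp only [map_sub, map_neg, map_smul]
    module
  · intro v _
    rw [norm_smul, hnorm, one_mul]
    exact T.norm_op_apply_le _ _

/-! ### The resolvent as the Laplace transform of the semigroup -/

lemma integrable_exp_neg_mul {l : ℂ} (hl : 0 < l.re) :
    Integrable (fun s : ℝ => Complex.exp (-l * s)) (volume.restrict (Set.Ioi 0)) :=
  integrableOn_exp_mul_complex_Ioi (by simpa using hl) 0

/-- The resolvent `(l + A)⁻¹ = ∫₀^∞ e^{-ls} T(s) ds`, where `-A` is the generator of `T`. -/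
noncomputable def resolvent (T : BoundedC0Semigroup X) {l : ℂ} (hl : 0 < l.re) : X →L[ℂ] X :=
  T.hillePhillips (.pushforward _ Real.toNNReal (integrable_exp_neg_mul hl))

lemma resolvent_apply (T : BoundedC0Semigroup X) {l : ℂ} (hl : 0 < l.re) (x : X) :
    T.resolvent hl x = ∫ s : ℝ in Set.Ioi 0, Complex.exp (-l * s) • T.op s.toNNReal x :=
  T.hillePhillips_pushforward _ measurable_real_toNNReal _ x

lemma integrableOn_resolvent (T : BoundedC0Semigroup X) {l : ℂ} (hl : 0 < l.re) (x : X) :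
    IntegrableOn (fun s : ℝ => Complex.exp (-l * s) • T.op s.toNNReal x) (Set.Ioi 0) := by
  have hw := integrable_exp_neg_mul hl
  refine (hw.norm.mul_const (T.bound * ‖x‖)).mono'
    (hw.aestronglyMeasurable.smul (T.continuous_orbit x).aestronglyMeasurable)
    (Eventually.of_forall fun s => ?_)
  rw [norm_smul]
  exact mul_le_mul_of_nonneg_left (T.norm_op_apply_le _ _) (norm_nonneg _)

/-- `ε e^{-εs} ds` is a probability measure, so `ε(ε+A)⁻¹` averages the orbit; the bound is uniform
in `ε`. -/
lemma norm_mul_resolvent_le (T : BoundedC0Semigroup X) {ε : ℝ} (hε : 0 < (ε : ℂ).re) (x : X) :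
    ‖(ε : ℂ) • T.resolvent hε x‖ ≤ T.bound * ‖x‖ := by
  have hε' : 0 < ε := by simpa using hε
  rw [norm_smul, resolvent_apply]
  have h1 : ‖∫ s : ℝ in Set.Ioi 0, Complex.exp (-ε * s) • T.op s.toNNReal x‖ ≤
      ∫ s : ℝ in Set.Ioi 0, Real.exp (-ε * s) * (T.bound * ‖x‖) := by
    refine norm_integral_le_of_norm_le ?_ (Eventually.of_forall fun s => ?_)
    · exact (integrableOn_exp_mul_Ioi (by linarith) 0).mul_const _
    · rw [norm_smul, Complex.norm_exp]
      refine mul_le_mul (le_of_eq (by simp)) (T.norm_op_apply_le _ _) (norm_nonneg _)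
        (Real.exp_pos _).le
  rw [integral_mul_const, integral_exp_mul_Ioi (by linarith)] at h1
  simp only [Complex.norm_real, Real.norm_eq_abs, abs_of_pos hε']
  calc _ ≤ ε * (-Real.exp (-ε * 0) / -ε * (T.bound * ‖x‖)) := by gcongr
    _ = T.bound * ‖x‖ := by
      rw [mul_zero, Real.exp_zero, neg_div_neg_eq]
      field_simp

variable [CompleteSpace X]

lemma resolvent_mem_calculusGraph (T : BoundedC0Semigroup X) {l : ℂ} (hl : 0 < l.re) :
    ((fun z => ((z : ℂ) + l)⁻¹, T.resolvent hl) :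
      ({z : ℂ // 0 < z.re} → ℂ) × (X →L[ℂ] X)) ∈ T.calculusGraph := by
  refine T.pushforward_mem_calculusGraph _ measurable_real_toNNReal _ fun z => ?_
  have hre : (-((z : ℂ) + l)).re < 0 := by
    simp only [Complex.neg_re, Complex.add_re]
    linarith [z.2]
  have h := integral_exp_mul_complex_Ioi hre 0
  simp only [Complex.ofReal_zero, mul_zero, Complex.exp_zero, neg_div_neg_eq, one_div] at h
  rw [← h]
  refine setIntegral_congr_fun measurableSet_Ioi fun s hs => ?_
  rw [Real.coe_toNNReal _ (le_of_lt hs), ← Complex.exp_add]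
  ring_nf

/-- Translating the integral gives `T(h)Rx = e^{lh}(Rx - ∫₀ʰ e^{-ls}T(s)x ds)`. The right side makes
sense for all real `h` and is differentiable at 0. -/
lemma tendsto_op_resolvent (T : BoundedC0Semigroup X) {l : ℂ} (hl : 0 < l.re) (x : X) :
    Tendsto (fun h : ℝ≥0 => ((h : ℝ)⁻¹ : ℂ) • (T.op h (T.resolvent hl x) - T.resolvent hl x))
      (𝓝[>] 0) (𝓝 (l • T.resolvent hl x - x)) := by
  set g : ℝ → X := fun s => Complex.exp (-l * s) • T.op s.toNNReal x with hg
  have hgc : Continuous g := (by fun_prop : Continuous fun s : ℝ => Complex.exp (-l * s)).smul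
    (T.continuous_orbit x)
  have hgi : IntegrableOn g (Set.Ioi 0) := T.integrableOn_resolvent hl x
  have h1 : HasDerivAt (fun h : ℝ => Complex.exp (l * h)) l 0 := by
    have := ((hasDerivAt_id ((0 : ℝ) : ℂ)).const_mul l).cexp.comp_ofReal
    simpa using this
  have h2 : HasDerivAt (fun h : ℝ => T.resolvent hl x - ∫ s in (0 : ℝ)..h, g s) (-x) 0 := by
    have := (intervalIntegral.integral_hasDerivAt_right (hgc.intervalIntegrable 0 0)
      hgc.stronglyMeasurable.stronglyMeasurableAtFilter hgc.continuousAt).const_sub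
      (T.resolvent hl x)
    simpa [hg, T.map_zero] using this
  have h3 := h1.smul h2
  simp only [Complex.ofReal_zero, mul_zero, Complex.exp_zero, one_smul,
    intervalIntegral.integral_same, sub_zero] at h3
  rw [neg_add_eq_sub] at h3
  refine tendsto_of_hasDerivAt h3 fun h => ?_
  have h4 : T.resolvent hl x - ∫ s in (0 : ℝ)..h, g s = ∫ s in Set.Ioi (h : ℝ), g s := by
    rw [T.resolvent_apply hl x, ← intervalIntegral.integral_Ioi_sub_Ioi hgi h.coe_nonneg]
    exact sub_sub_cancel _ _
  have h5 := (measurePreserving_add_right volume (h : ℝ)).setIntegral_preimage_emb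
    (measurableEmbedding_addRight (h : ℝ)) g (Set.Ioi (h : ℝ))
  rw [Set.preimage_add_const_Ioi, sub_self] at h5
  simp only [Pi.smul_apply']
  rw [h4, ← h5, resolvent_apply, ← ContinuousLinearMap.integral_comp_comm _ hgi, ← integral_smul]
  refine setIntegral_congr_fun measurableSet_Ioi fun s hs => ?_
  have hs : 0 < s := hs
  have hadd : (s + h).toNNReal = h + s.toNNReal := by
    rw [Real.toNNReal_add hs.le h.coe_nonneg, Real.toNNReal_coe, add_comm]
  simp only [hg, map_smul, hadd, T.map_add, mul_apply_eq_comp, smul_smul]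
  rw [← Complex.exp_add]
  congr 2
  push_cast
  ring

lemma op_resolvent (T : BoundedC0Semigroup X) {l : ℂ} (hl : 0 < l.re) (t : ℝ≥0) (x : X) :
    T.op t (T.resolvent hl x) = T.resolvent hl (T.op t x) := by
  rw [resolvent_apply, resolvent_apply, ← ContinuousLinearMap.integral_comp_comm _
    (T.integrableOn_resolvent hl x)]
  refine integral_congr_ae (Eventually.of_forall fun s => ?_)
  simp only [map_smul]
  rw [← mul_apply_eq_comp, ← mul_apply_eq_comp, ← T.map_add, ← T.map_add, add_comm]

lemma exists_apply_resolvent (hA : T.IsGenerator (-A)) {l : ℂ} (hl : 0 < l.re) (y : X) :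
    ∃ h : T.resolvent hl y ∈ A.domain, A ⟨T.resolvent hl y, h⟩ = y - l • T.resolvent hl y := by
  obtain ⟨h, hy⟩ := (isGenerator_neg_iff hA _ _).2 (T.tendsto_op_resolvent hl y)
  exact ⟨h, hy.trans (neg_sub _ _)⟩

/-- The resolvent commutes with the semigroup, so it may be applied to the difference quotients of
`x`, giving those of its image; their limits are compared. -/
lemma resolvent_apply_apply (hA : T.IsGenerator (-A)) {l : ℂ} (hl : 0 < l.re) (x : A.domain) :
    T.resolvent hl (A x) = x - l • T.resolvent hl x := by
  have h1 := (isGenerator_neg_iff hA x (-A x)).1 ⟨x.2, (neg_neg _).symm⟩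
  have h2 := ((T.resolvent hl).continuous.tendsto _).comp h1
  have h3 := tendsto_nhds_unique (h2.congr fun h => by
    simp only [Function.comp_apply, map_smul, map_sub, ← op_resolvent])
    (T.tendsto_op_resolvent hl x)
  rw [map_neg] at h3
  rw [← neg_neg (T.resolvent hl (A x)), h3, neg_sub]

lemma boundedInverse_affine_one (hA : T.IsGenerator (-A)) {h : ℝ} (hh : 0 < h)
    (hl : 0 < ((h⁻¹ : ℝ) : ℂ).re) :
    boundedInverse (affine A 1 (h : ℂ)) = ((h⁻¹ : ℝ) : ℂ) • T.resolvent hl := by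
  have hh' : (h : ℂ) ≠ 0 := by exact_mod_cast hh.ne'
  refine boundedInverse_eq (isBoundedInverse_affine_iff.2 ⟨fun y => ?_, fun x => ?_⟩)
  · obtain ⟨hy, hAy⟩ := exists_apply_resolvent hA hl y
    refine ⟨A.domain.smul_mem _ hy, ?_⟩
    have : A (((h⁻¹ : ℝ) : ℂ) • ⟨T.resolvent hl y, hy⟩ : A.domain) =
        ((h⁻¹ : ℝ) : ℂ) • (y - ((h⁻¹ : ℝ) : ℂ) • T.resolvent hl y) := by
      rw [LinearPMap.map_smul, hAy]
    refine (congrArg (fun v => (1 : ℂ) • (((h⁻¹ : ℝ) : ℂ) • T.resolvent hl y) + (h : ℂ) • v)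
      this).trans ?_
    simp [smul_sub, smul_smul, hh']
  · rw [smul_apply, _root_.map_add, map_smul, map_smul, resolvent_apply_apply hA hl]
    have h1 : ((h⁻¹ : ℝ) : ℂ) * h = 1 := by simp [hh']
    have h2 : (h : ℂ) * ((h⁻¹ : ℝ) : ℂ) = 1 := by rw [mul_comm, h1]
    rw [one_smul, smul_sub, smul_smul, h2, one_smul, add_sub_cancel, smul_smul, h1, one_smul]

/-- Mean ergodic argument: `ε(ε+A)⁻¹` fixes `ker A`, is bounded uniformly in `ε`, and tends to 0 on
`ran A` as `ε → 0`. Hence `‖x‖ ≤ M‖x - y‖` for `y` in `ran A`, by density for all `y`, in particular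
for `y = x`. -/
lemma injective_of_dense_range (hA : T.IsGenerator (-A)) (hran : Dense (Set.range A))
    (x : A.domain) (hx : A x = 0) : (x : X) = 0 := by
  have hpos : ∀ {ε : ℝ}, 0 < ε → 0 < (ε : ℂ).re := fun {ε} h => by simpa using h
  have hfix : ∀ {ε : ℝ} (hε : 0 < ε), (ε : ℂ) • T.resolvent (hpos hε) (x : X) = x :=
      fun {ε} hε => by
    have := resolvent_apply_apply hA (hpos hε) x
    rw [hx, _root_.map_zero] at this
    exact (sub_eq_zero.1 this.symm).symm
  have hsmall : ∀ {ε : ℝ} (hε : 0 < ε) (u : A.domain),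
      ‖(ε : ℂ) • T.resolvent (hpos hε) (A u)‖ ≤ ε * (‖(u : X)‖ + T.bound * ‖(u : X)‖) :=
    fun {ε} hε u => by
    rw [resolvent_apply_apply hA (hpos hε) u, norm_smul, Complex.norm_real,
      Real.norm_of_nonneg hε.le]
    gcongr
    exact (norm_sub_le _ _).trans (by gcongr; exact T.norm_mul_resolvent_le _ _)
  have hle : ∀ u : A.domain, ‖(x : X)‖ ≤ T.bound * ‖(x : X) - A u‖ := fun u => by
    have hlim : Tendsto (fun ε : ℝ => T.bound * ‖(x : X) - A u‖ +
        ε * (‖(u : X)‖ + T.bound * ‖(u : X)‖)) (𝓝[>] 0) (𝓝 (T.bound * ‖(x : X) - A u‖)) := by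
      have : Continuous fun ε : ℝ => T.bound * ‖(x : X) - A u‖ +
        ε * (‖(u : X)‖ + T.bound * ‖(u : X)‖) := by fun_prop
      simpa using (this.tendsto 0).mono_left (nhdsWithin_le_nhds (s := Set.Ioi (0 : ℝ)))
    refine ge_of_tendsto hlim ?_
    filter_upwards [self_mem_nhdsWithin] with ε hε
    have hε : 0 < ε := hε
    have hsplit : (x : X) = (ε : ℂ) • T.resolvent (hpos hε) ((x : X) - A u) +
        (ε : ℂ) • T.resolvent (hpos hε) (A u) := by
      rw [← smul_add, ← _root_.map_add, sub_add_cancel, hfix hε]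
    calc ‖(x : X)‖ = ‖(ε : ℂ) • T.resolvent (hpos hε) ((x : X) - A u) +
        (ε : ℂ) • T.resolvent (hpos hε) (A u)‖ := congrArg norm hsplit
      _ ≤ _ := (norm_add_le _ _).trans (add_le_add (T.norm_mul_resolvent_le _ _) (hsmall hε u))
  have hcl : ∀ y : X, ‖(x : X)‖ ≤ T.bound * ‖(x : X) - y‖ := fun y => by
    refine hran.induction ?_ ?_ y
    · rintro _ ⟨u, rfl⟩
      exact hle u
    · exact isClosed_le continuous_const (by fun_prop)
  have := hcl x
  rw [sub_self, norm_zero, mul_zero] at this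
  exact norm_le_zero_iff.1 this

/-- Otherwise `z - A` is bounded below by `c` at `z = is`, which controls the resolvent `R = (ε - z
+ A)⁻¹` at the nearby point `z - ε`. Then `z - A = -(1 - εR)(ε - z + A)` is inverted by a Neumann
series, and `z` is not in the spectrum. -/
lemma exists_approximate_eigenvector (hA : T.IsGenerator (-A)) {s : ℝ}
    (hs : Complex.I * s ∈ spectrum A) {c : ℝ} (hc : 0 < c) :
    ∃ x : A.domain, ‖(Complex.I * s) • (x : X) - A x‖ < c * ‖(x : X)‖ := by
  by_contra! hcon
  refine hs ?_
  set z : ℂ := Complex.I * s with hz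
  -- The lower bound gives `‖R‖ ≤ 1/(c-ε)`; with `ε = c/3` this makes `‖εR‖ ≤ 1/2`.
  set ε : ℝ := c / 3 with hε
  have hε0 : 0 < ε := by positivity
  have hl : 0 < ((ε : ℂ) - z).re := by simpa [hz] using hε0
  set R := T.resolvent hl with hRdef
  have hRA := exists_apply_resolvent hA hl
  have hRle : ∀ y, ‖R y‖ ≤ (c - ε)⁻¹ * ‖y‖ := fun y => by
    obtain ⟨hy, hAy⟩ := hRA y
    have h1 := hcon ⟨R y, hy⟩
    have h2 : z • R y - A ⟨R y, hy⟩ = (ε : ℂ) • R y - y := by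
      refine (congrArg (fun v => z • R y - v) hAy).trans ?_
      module
    have h3 : c * ‖R y‖ ≤ ε * ‖R y‖ + ‖y‖ := by
      refine (h1.trans_eq (congrArg norm h2)).trans ((norm_sub_le _ _).trans_eq ?_)
      rw [norm_smul, Complex.norm_real, Real.norm_of_nonneg hε0.le]
    rw [inv_mul_eq_div, le_div_iff₀ (by linarith)]
    linarith
  have hlt : ‖(ε : ℂ) • R‖ < 1 := by
    rw [norm_smul, Complex.norm_real, Real.norm_of_nonneg hε0.le]
    have h1 : ‖R‖ ≤ (c - ε)⁻¹ :=
      R.opNorm_le_bound (inv_nonneg.2 (by linarith)) hRle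
    calc ε * ‖R‖ ≤ ε * (c - ε)⁻¹ := by gcongr
      _ = 1 / 2 := by
        rw [hε]
        field_simp
        norm_num
      _ < 1 := by norm_num
  set U := Units.oneSub ((ε : ℂ) • R) hlt with hU
  have hUval : (U : X →L[ℂ] X) = 1 - (ε : ℂ) • R := rfl
  have hU1 : ∀ y, (↑U⁻¹ : X →L[ℂ] X) y - (ε : ℂ) • R ((↑U⁻¹ : X →L[ℂ] X) y) = y := fun y => by
    have := congrArg (fun V : X →L[ℂ] X => V y) U.mul_inv
    rw [hUval] at this
    simpa using this
  have hU2 : ∀ y, (↑U⁻¹ : X →L[ℂ] X) (y - (ε : ℂ) • R y) = y := fun y => by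
    have := congrArg (fun V : X →L[ℂ] X => V y) U.inv_mul
    rw [hUval] at this
    simpa using this
  refine ⟨-(R * (↑U⁻¹ : X →L[ℂ] X)), isBoundedInverse_affine_iff.2 ⟨fun y => ?_, fun x => ?_⟩⟩
  · obtain ⟨hy, hAy⟩ := hRA ((↑U⁻¹ : X →L[ℂ] X) y)
    refine ⟨A.domain.neg_mem hy, ?_⟩
    have : A (-⟨T.resolvent hl ((↑U⁻¹ : X →L[ℂ] X) y), hy⟩ : A.domain) = _ :=
      (LinearPMap.map_neg _ _).trans (congrArg Neg.neg hAy)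
    refine (congrArg (fun v => z • -R ((↑U⁻¹ : X →L[ℂ] X) y) + (-1 : ℂ) • v) this).trans
      (Eq.trans ?_ (hU1 y))
    module
  · have hx := resolvent_apply_apply hA hl x
    have : z • (x : X) + (-1 : ℂ) • A x =
        -((((ε : ℂ) - z) • (x : X) + A x) - (ε : ℂ) • R (((ε : ℂ) - z) • (x : X) + A x)) := by
      rw [_root_.map_add, map_smul, hRdef, hx]
      module
    rw [this, neg_apply, map_neg, neg_neg, mul_apply_eq_comp, hU2, _root_.map_add, map_smul, hRdef,
      hx]
    abel

/-- Spectral inclusion on the imaginary axis. -/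
lemma norm_laplace_le_norm_hillePhillips (hA : T.IsGenerator (-A)) {s : ℝ}
    (hs : Complex.I * s ∈ spectrum A) (ν : FiniteComplexMeasure) :
    ‖ν.laplace (Complex.I * s)‖ ≤ ‖T.hillePhillips ν‖ := by
  set z : ℂ := Complex.I * s with hz
  have hzre : 0 ≤ z.re := by simp [hz]
  set M := T.bound with hM
  have hM0 : 0 ≤ M := T.bound_nonneg
  -- The relative error on a `c`-approximate eigenvector. The first bound tends to 0 with `c` for
  -- each `u`; the second is integrable without a first moment of `ν`, so dominated convergence
  -- gives `δ c → 0`.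
  set δ : ℝ → ℝ := fun c => ∫ u, ‖ν.density u‖ * min (M * c * u) (M + 1) ∂ν.base with hδ
  have hbound : ∀ {c : ℝ}, 0 ≤ c → ∀ u : ℝ≥0,
      ‖‖ν.density u‖ * min (M * c * u) (M + 1)‖ ≤ ‖ν.density u‖ * (M + 1) := fun {c} hc u => by
    have h0 : 0 ≤ min (M * c * u) (M + 1) := le_min (by positivity) (by positivity)
    rw [norm_mul, norm_norm, Real.norm_of_nonneg h0]
    exact mul_le_mul_of_nonneg_left (min_le_right _ _) (norm_nonneg _)
  have hmeas : ∀ c : ℝ, AEStronglyMeasurable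
      (fun u : ℝ≥0 => ‖ν.density u‖ * min (M * c * u) (M + 1)) ν.base := fun c =>
    ν.integrable.norm.aestronglyMeasurable.mul (Continuous.aestronglyMeasurable (by fun_prop))
  have hint : ∀ {c : ℝ}, 0 ≤ c →
      Integrable (fun u : ℝ≥0 => ‖ν.density u‖ * min (M * c * u) (M + 1)) ν.base := fun {c} hc =>
    (ν.integrable.norm.mul_const (M + 1)).mono' (hmeas c) (Eventually.of_forall (hbound hc))
  have hδlim : Tendsto δ (𝓝[>] 0) (𝓝 0) := by
    have : Tendsto δ (𝓝[>] 0) (𝓝 (∫ _u, (0 : ℝ) ∂ν.base)) := by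
      refine tendsto_integral_filter_of_dominated_convergence _
        (Eventually.of_forall hmeas) ?_ (ν.integrable.norm.mul_const (M + 1)) ?_
      · filter_upwards [self_mem_nhdsWithin] with c hc
        exact Eventually.of_forall (hbound (le_of_lt hc))
      · refine Eventually.of_forall fun u => ?_
        have hcont : Continuous fun c : ℝ => ‖ν.density u‖ * min (M * c * u) (M + 1) := by fun_prop
        have := (hcont.tendsto 0).mono_left (nhdsWithin_le_nhds (s := Set.Ioi (0 : ℝ)))
        simpa [min_eq_left (add_nonneg hM0 zero_le_one)] using this
    simpa using this
  have hlim : Tendsto (fun c => ‖T.hillePhillips ν‖ + δ c) (𝓝[>] 0) (𝓝 ‖T.hillePhillips ν‖) := by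
    simpa using hδlim.const_add ‖T.hillePhillips ν‖
  refine ge_of_tendsto hlim ?_
  filter_upwards [self_mem_nhdsWithin] with c hc
  have hc : 0 < c := hc
  obtain ⟨x, hx⟩ := exists_approximate_eigenvector hA hs hc
  have hx0 : 0 < ‖(x : X)‖ := by
    have := (norm_nonneg _).trans_lt hx
    exact pos_of_mul_pos_right this hc.le
  have hdiff : ‖T.hillePhillips ν x - ν.laplace z • (x : X)‖ ≤ δ c * ‖(x : X)‖ := by
    have h1 : T.hillePhillips ν x - ν.laplace z • (x : X) =
        ∫ u, ν.density u • (T.op u x - Complex.exp (-((u : ℝ) : ℂ) * z) • (x : X)) ∂ν.base := by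
      rw [hillePhillips_apply, FiniteComplexMeasure.laplace_eq, ← integral_smul_const,
        ← integral_sub (T.integrable_orbit ν x) ((ν.integrable_smul
          (FiniteComplexMeasure.continuous_laplaceKernel z)
          (FiniteComplexMeasure.norm_laplaceKernel_le hzre)).smul_const _)]
      simp only [smul_sub, smul_assoc]
    rw [h1, hδ, ← integral_mul_const]
    refine norm_integral_le_of_norm_le ((hint hc.le).mul_const _) (Eventually.of_forall fun u => ?_)
    rw [norm_smul, mul_assoc]
    refine mul_le_mul_of_nonneg_left ?_ (norm_nonneg _)
    rw [min_mul_of_nonneg _ _ hx0.le]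
    refine le_min ?_ ?_
    · calc _ ≤ M * ‖z • (x : X) - A x‖ * u := norm_op_sub_exp_le hA x s u
        _ ≤ M * (c * ‖(x : X)‖) * u := by gcongr
        _ = M * c * u * ‖(x : X)‖ := by ring
    · refine (norm_sub_le _ _).trans ?_
      rw [norm_smul, add_mul]
      exact add_le_add (T.norm_op_apply_le _ _) (mul_le_mul_of_nonneg_right
        (FiniteComplexMeasure.norm_laplaceKernel_le hzre u) (norm_nonneg _))
  have hfin : ‖ν.laplace z‖ * ‖(x : X)‖ ≤ (‖T.hillePhillips ν‖ + δ c) * ‖(x : X)‖ := by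
    rw [← norm_smul, add_mul]
    calc ‖ν.laplace z • (x : X)‖ = ‖T.hillePhillips ν x -
        (T.hillePhillips ν x - ν.laplace z • (x : X))‖ := by rw [sub_sub_cancel]
      _ ≤ _ := (norm_sub_le _ _).trans (add_le_add (ContinuousLinearMap.le_opNorm _ _) hdiff)
  exact le_of_mul_le_mul_right hfin hx0

end BoundedC0Semigroup

end Generator

/-! ### Laplace transforms related to Euler's approximation -/

section LaplaceAlgebra

variable {X : Type*} [NormedAddCommGroup X] [NormedSpace ℂ X] [CompleteSpace X]

namespace BoundedC0Semigroup

variable (T : BoundedC0Semigroup X)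

/-- The algebra of Laplace transforms of finite complex measures, on the right half-plane. -/
noncomputable def laplaceAlgebra : Subalgebra ℂ ({z : ℂ // 0 < z.re} → ℂ) :=
  T.calculusGraph.map (AlgHom.fst ℂ _ _)

lemma mem_laplaceAlgebra_iff {g : {z : ℂ // 0 < z.re} → ℂ} :
    g ∈ T.laplaceAlgebra ↔ ∃ G, (g, G) ∈ T.calculusGraph := by
  constructor
  · rintro ⟨⟨g, G⟩, h, rfl⟩
    exact ⟨G, h⟩
  · rintro ⟨G, h⟩
    exact ⟨(g, G), h, rfl⟩

lemma mem_laplaceAlgebra_of_laplace {g : {z : ℂ // 0 < z.re} → ℂ} (μ : FiniteComplexMeasure)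
    (h : ∀ z : {z : ℂ // 0 < z.re}, μ.laplace z = g z) : g ∈ T.laplaceAlgebra :=
  T.mem_laplaceAlgebra_iff.2 ⟨_, μ, h, rfl⟩

lemma inv_add_mem_laplaceAlgebra {l : ℂ} (hl : 0 < l.re) :
    (fun z : {z : ℂ // 0 < z.re} => ((z : ℂ) + l)⁻¹) ∈ T.laplaceAlgebra :=
  T.mem_laplaceAlgebra_iff.2 ⟨_, T.resolvent_mem_calculusGraph hl⟩

lemma ne_zero_of_re_pos (z : {z : ℂ // 0 < z.re}) : (z : ℂ) ≠ 0 := fun h => by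
  have := z.2
  rw [h] at this
  exact lt_irrefl _ this

lemma add_ofReal_ne_zero (z : {z : ℂ // 0 < z.re}) {a : ℝ} (ha : 0 ≤ a) : (z : ℂ) + a ≠ 0 :=
  fun h => by
    have := congrArg Complex.re h
    have hz := z.2
    simp at this
    linarith

lemma one_add_mul_ne_zero (z : {z : ℂ // 0 < z.re}) {a : ℝ} (ha : 0 ≤ a) :
    1 + (a : ℂ) * (z : ℂ) ≠ 0 :=
  fun h => by
    have := congrArg Complex.re h
    have hz := mul_nonneg ha z.2.le
    simp at this
    linarith

lemma integral_exp_mem_laplaceAlgebra {h : ℝ} (hh : 0 < h) :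
    (fun z : {z : ℂ // 0 < z.re} => (1 - Complex.exp (-(h : ℂ) * z)) / z) ∈ T.laplaceAlgebra := by
  have hw : Integrable (fun _ : ℝ => (1 : ℂ)) (volume.restrict (Set.Ioc 0 h)) :=
    integrable_const 1
  refine T.mem_laplaceAlgebra_of_laplace (.pushforward _ Real.toNNReal hw) fun z => ?_
  rw [FiniteComplexMeasure.laplace_pushforward _ measurable_real_toNNReal hw z.2.le]
  have hz := ne_zero_of_re_pos z
  have h1 : ∫ s : ℝ in (0 : ℝ)..h, Complex.exp (-(z : ℂ) * s) = _ :=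
    integral_exp_mul_complex (neg_ne_zero.2 hz)
  rw [intervalIntegral.integral_of_le hh.le] at h1
  calc _ = ∫ s : ℝ in Set.Ioc 0 h, Complex.exp (-(z : ℂ) * s) := by
        refine setIntegral_congr_fun measurableSet_Ioc fun s hs => ?_
        rw [Real.coe_toNNReal _ hs.1.le, one_mul]
        ring_nf
    _ = _ := by
        rw [h1]
        simp only [Complex.ofReal_zero, mul_zero, Complex.exp_zero]
        field_simp
        ring_nf

/-- This is the Taylor remainder `(e^{-hz} - 1 + hz)/z²`, the transform of the density `h - s` on
`(0, h]`. -/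
lemma integral_sub_mul_exp_mem_laplaceAlgebra {h : ℝ} (hh : 0 < h) :
    (fun z : {z : ℂ // 0 < z.re} => ((h : ℂ) - (1 - Complex.exp (-(h : ℂ) * z)) / z) / z) ∈
      T.laplaceAlgebra := by
  have hw : Integrable (fun s : ℝ => (h : ℂ) - s) (volume.restrict (Set.Ioc 0 h)) :=
    (Continuous.integrableOn_Ioc (by fun_prop))
  refine T.mem_laplaceAlgebra_of_laplace (.pushforward _ Real.toNNReal hw) fun z => ?_
  rw [FiniteComplexMeasure.laplace_pushforward _ measurable_real_toNNReal hw z.2.le]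
  have hz := ne_zero_of_re_pos z
  have h1 : ∫ s : ℝ in (0 : ℝ)..h, ((h : ℂ) - s) * Complex.exp (-(z : ℂ) * s) =
      (-((h : ℂ) - h) * Complex.exp (-(z : ℂ) * h) / z + Complex.exp (-(z : ℂ) * h) / z ^ 2) -
      (-((h : ℂ) - (0 : ℝ)) * Complex.exp (-(z : ℂ) * (0 : ℝ)) / z +
        Complex.exp (-(z : ℂ) * (0 : ℝ)) / z ^ 2) := by
    refine intervalIntegral.integral_eq_sub_of_hasDerivAt
      (f := fun s : ℝ => -((h : ℂ) - s) * Complex.exp (-(z : ℂ) * s) / z +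
        Complex.exp (-(z : ℂ) * s) / z ^ 2) (fun s _ => ?_)
      (Continuous.intervalIntegrable (by fun_prop) _ _)
    have e1 : HasDerivAt (fun s : ℂ => Complex.exp (-(z : ℂ) * s))
        (Complex.exp (-(z : ℂ) * s) * -(z : ℂ)) (s : ℂ) := by
      simpa using ((hasDerivAt_id (s : ℂ)).const_mul (-(z : ℂ))).cexp
    have e2 : HasDerivAt (fun s : ℂ => -((h : ℂ) - s)) 1 (s : ℂ) := by
      exact ((hasDerivAt_id (s : ℂ)).const_sub (h : ℂ)).neg.congr_deriv (neg_neg 1)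
    have e3 := (((e2.mul e1).div_const (z : ℂ)).add (e1.div_const ((z : ℂ) ^ 2))).comp_ofReal
    refine e3.congr_deriv ?_
    field_simp
    ring
  rw [intervalIntegral.integral_of_le hh.le] at h1
  calc _ = ∫ s : ℝ in Set.Ioc 0 h, ((h : ℂ) - s) * Complex.exp (-(z : ℂ) * s) := by
        refine setIntegral_congr_fun measurableSet_Ioc fun s hs => ?_
        rw [Real.coe_toNNReal _ hs.1.le]
        ring_nf
    _ = _ := by
        rw [h1]
        simp only [Complex.ofReal_zero, mul_zero, Complex.exp_zero]
        field_simp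
        ring_nf

lemma exp_mem_laplaceAlgebra (t : ℝ≥0) :
    (fun z : {z : ℂ // 0 < z.re} => Complex.exp (-((t : ℝ) : ℂ) * z)) ∈ T.laplaceAlgebra :=
  T.mem_laplaceAlgebra_iff.2 ⟨_, T.op_mem_calculusGraph t⟩

lemma inv_one_add_mul_mem_laplaceAlgebra {h : ℝ} (hh : 0 < h) :
    (fun z : {z : ℂ // 0 < z.re} => (1 + (h : ℂ) * z)⁻¹) ∈ T.laplaceAlgebra := by
  have hl : 0 < ((h⁻¹ : ℝ) : ℂ).re := by simpa using hh
  have := T.laplaceAlgebra.smul_mem (T.inv_add_mem_laplaceAlgebra hl) ((h⁻¹ : ℝ) : ℂ)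
  convert this using 1
  funext z
  have h1 := one_add_mul_ne_zero z hh.le
  have h2 := add_ofReal_ne_zero z (inv_nonneg.2 hh.le)
  have h3 : (h : ℂ) ≠ 0 := by exact_mod_cast hh.ne'
  simp only [Pi.smul_apply, smul_eq_mul]
  push_cast at h2 ⊢
  rw [← mul_inv, mul_add, mul_inv_cancel₀ h3, add_comm]

/-- The scalar version `(1 + (t/n) z)⁻ⁿ - e^{-tz}` of `eulerError`. -/
noncomputable def scalarEulerError (n : ℕ) (t : ℝ≥0) (z : ℂ) : ℂ :=
  ((1 + (((t : ℝ) / (n : ℝ) : ℝ) : ℂ) * z)⁻¹) ^ n - Complex.exp (-((t : ℝ) : ℂ) * z)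

lemma eulerError_mem_calculusGraph {A : X →ₗ.[ℂ] X} (hA : T.IsGenerator (-A)) {n : ℕ} {t : ℝ≥0}
    (hn : 0 < n) (ht : 0 < t) :
    ((fun z => scalarEulerError n t z, eulerError T A n t) :
      ({z : ℂ // 0 < z.re} → ℂ) × (X →L[ℂ] X)) ∈ T.calculusGraph := by
  have hh : 0 < (t : ℝ) / (n : ℝ) := div_pos (by exact_mod_cast ht) (by exact_mod_cast hn)
  set h := (t : ℝ) / (n : ℝ) with hdef
  have hl : 0 < ((h⁻¹ : ℝ) : ℂ).re := by simpa using hh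
  have h1 := T.calculusGraph.sub_mem (T.calculusGraph.pow_mem
    (T.calculusGraph.smul_mem (T.resolvent_mem_calculusGraph hl) ((h⁻¹ : ℝ) : ℂ)) n)
    (T.op_mem_calculusGraph t)
  convert h1 using 1
  refine Prod.ext ?_ ?_
  · funext z
    have h1 := one_add_mul_ne_zero z hh.le
    have h2 := add_ofReal_ne_zero z (inv_nonneg.2 hh.le)
    have h3 : (h : ℂ) ≠ 0 := by exact_mod_cast hh.ne'
    simp only [scalarEulerError, ← hdef, Prod.fst_sub, Prod.pow_fst, Prod.smul_fst, Pi.sub_apply,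
      Pi.pow_apply, Pi.smul_apply, smul_eq_mul]
    push_cast at h2 ⊢
    rw [← mul_inv, mul_add, mul_inv_cancel₀ h3, add_comm]
  · simp only [eulerError, Prod.snd_sub, Prod.pow_snd, Prod.smul_snd]
    rw [boundedInverse_affine_one hA hh hl]

/-- The Euler error vanishes to second order at the origin. -/
lemma scalarEulerError_mul_mem_laplaceAlgebra {n : ℕ} {t : ℝ≥0} (hn : 0 < n) (ht : 0 < t) :
    (fun z : {z : ℂ // 0 < z.re} => scalarEulerError n t z * (((z : ℂ) + 1) / z) ^ 2) ∈
      T.laplaceAlgebra := by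
  have hh : 0 < (t : ℝ) / (n : ℝ) := div_pos (by exact_mod_cast ht) (by exact_mod_cast hn)
  set h := (t : ℝ) / (n : ℝ) with hdef
  have hr := T.inv_one_add_mul_mem_laplaceAlgebra hh
  have he := T.exp_mem_laplaceAlgebra ⟨h, hh.le⟩
  have hE := T.integral_exp_mem_laplaceAlgebra hh
  have hF := T.integral_sub_mul_exp_mem_laplaceAlgebra hh
  set r : {z : ℂ // 0 < z.re} → ℂ := fun z => (1 + (h : ℂ) * z)⁻¹ with hrdef
  set e : {z : ℂ // 0 < z.re} → ℂ := fun z => Complex.exp (-(h : ℂ) * z) with hedef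
  set E : {z : ℂ // 0 < z.re} → ℂ := fun z => (1 - Complex.exp (-(h : ℂ) * z)) / z with hEdef
  set F : {z : ℂ // 0 < z.re} → ℂ :=
    fun z => ((h : ℂ) - (1 - Complex.exp (-(h : ℂ) * z)) / z) / z with hFdef
  have he : e ∈ T.laplaceAlgebra := he
  -- Expansion of `((z+1)/z)² = 1 + 2/z + 1/z²` against `r - e`, using `(r - e)/z = E - h r` and `(r
  -- - e)/z² = h² r - F`.
  have hD : (r - e) + (2 : ℂ) • (E - (h : ℂ) • r) + (((h : ℂ) ^ 2) • r - F) ∈ T.laplaceAlgebra :=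
    add_mem (add_mem (sub_mem hr he) (T.laplaceAlgebra.smul_mem
      (sub_mem hE (T.laplaceAlgebra.smul_mem hr _)) _))
      (sub_mem (T.laplaceAlgebra.smul_mem hr _) hF)
  -- The cofactor in `rⁿ - eⁿ = (∑ rᵏ eⁿ⁻¹⁻ᵏ)(r - e)`: one step of length `h = t/n` already carries
  -- the double zero, and `eⁿ = e^{-tz}`.
  have hS : ∑ k ∈ Finset.range n, r ^ k * e ^ (n - 1 - k) ∈ T.laplaceAlgebra :=
    sum_mem fun k _ => mul_mem (pow_mem hr _) (pow_mem he _)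
  convert mul_mem hS hD using 1
  funext z
  have hz := ne_zero_of_re_pos z
  have h1 := one_add_mul_ne_zero z hh.le
  have hD' : ((r - e) + (2 : ℂ) • (E - (h : ℂ) • r) + (((h : ℂ) ^ 2) • r - F)) z =
      (r z - e z) * (((z : ℂ) + 1) / z) ^ 2 := by
    simp only [Pi.add_apply, Pi.sub_apply, Pi.smul_apply, smul_eq_mul, hrdef, hedef, hEdef, hFdef]
    field_simp
    ring
  have hS' : (∑ k ∈ Finset.range n, r ^ k * e ^ (n - 1 - k)) z =
      ∑ k ∈ Finset.range n, r z ^ k * e z ^ (n - 1 - k) := by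
    simp [Finset.sum_apply]
  have hpow : e z ^ n = Complex.exp (-((t : ℝ) : ℂ) * z) := by
    have hn' : (n : ℂ) ≠ 0 := by exact_mod_cast hn.ne'
    rw [hedef, ← Complex.exp_nat_mul, hdef]
    congr 1
    push_cast
    field_simp
  rw [Pi.mul_apply, hD', hS', ← mul_assoc, (Commute.all (r z) (e z)).geom_sum₂_mul, hpow]
  rfl

end BoundedC0Semigroup

end LaplaceAlgebra

/-! ### Stieltjes functions -/

/-- Stieltjes functions represented by a finite measure. -/
lemma IsStieltjes.exists_finite_measure {f : ℂ → ℂ} (hf : IsStieltjes f) :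
    ∃ (a : ℝ) (ν : Measure ℝ≥0), 0 ≤ a ∧ IsFiniteMeasure ν ∧
      ∀ x : ℝ, 0 < x → f x = ((a + ∫ τ : ℝ≥0, (1 + (τ : ℝ)) / (x + (τ : ℝ)) ∂ν : ℝ) : ℂ) := by
  obtain ⟨-, a, μ, ha, hμ, hfx⟩ := hf
  refine ⟨a, μ.withDensity fun τ => ENNReal.ofReal (1 + (τ : ℝ))⁻¹, ha,
    isFiniteMeasure_withDensity_ofReal hμ.2, fun x hx => ?_⟩
  rw [hfx x hx, integral_withDensity_eq_integral_toReal_smul (by fun_prop)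
    (Eventually.of_forall fun _ => ENNReal.ofReal_lt_top)]
  congr 3
  refine funext fun τ => ?_
  have h1 : 0 < 1 + (τ : ℝ) := by positivity
  have h2 : 0 < x + (τ : ℝ) := by positivity
  rw [ENNReal.toReal_ofReal (inv_nonneg.2 h1.le), smul_eq_mul]
  field_simp

section FiniteMeasure

variable (ν : Measure ℝ≥0) [IsFiniteMeasure ν]

lemma add_coe_ne_zero {z : ℂ} (hz : 0 < z.re) (τ : ℝ≥0) : z + ((τ : ℝ) : ℂ) ≠ 0 := fun h => by
  have := congrArg Complex.re h
  simp at this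
  linarith [τ.coe_nonneg]

lemma integrable_stieltjesKernel {z : ℂ} (hz : 0 < z.re) :
    Integrable (fun τ : ℝ≥0 => (1 + ((τ : ℝ) : ℂ)) / (z + ((τ : ℝ) : ℂ))) ν := by
  refine (integrable_const (1 + z.re⁻¹)).mono' (Continuous.aestronglyMeasurable
    (Continuous.div (by fun_prop) (by fun_prop) (add_coe_ne_zero hz)))
    (Eventually.of_forall fun τ => ?_)
  have hτ := τ.coe_nonneg
  have h1 : ‖1 + ((τ : ℝ) : ℂ)‖ = 1 + τ := by
    rw [← Complex.ofReal_one, ← Complex.ofReal_add, Complex.norm_real, Real.norm_of_nonneg]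
    positivity
  have h2 : z.re + τ ≤ ‖z + ((τ : ℝ) : ℂ)‖ := by
    simpa using Complex.re_le_norm (z + ((τ : ℝ) : ℂ))
  rw [norm_div, h1]
  have h3 : 0 < z.re + τ := by positivity
  calc (1 + (τ : ℝ)) / ‖z + ((τ : ℝ) : ℂ)‖ ≤ (1 + τ) / (z.re + τ) := by gcongr
    _ ≤ 1 + z.re⁻¹ := by
      rw [div_le_iff₀ h3]
      have h4 : (1 + z.re⁻¹) * (z.re + τ) = 1 + τ + z.re + z.re⁻¹ * τ := by
        field_simp
        ring
      rw [h4]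
      have := mul_nonneg (inv_nonneg.2 hz.le) hτ
      linarith

/-- A finite mixture of exponential distributions. -/
lemma exists_laplace_eq_integral : ∃ κ : FiniteComplexMeasure, ∀ z : ℂ, 0 < z.re →
    κ.laplace z = ∫ τ : ℝ≥0, ((τ : ℝ) : ℂ) / (z + ((τ : ℝ) : ℂ)) ∂ν := by
  -- The density `τ e^{-τs}` is the image of `e^{-s}` under `s ↦ s/τ`. At `τ = 0` the quotient is 0
  -- by convention, which would create an atom at the origin; the weight removes it, matching
  -- `0/(z+0) = 0`.
  have hw1 : Integrable (fun τ : ℝ≥0 => if τ = 0 then (0 : ℂ) else 1) ν :=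
    (integrable_const (1 : ℝ)).mono' (Measurable.ite (measurableSet_singleton 0) measurable_const
      measurable_const).aestronglyMeasurable (Eventually.of_forall fun τ => by
        by_cases h : τ = 0 <;> simp [h])
  have hw2 : Integrable (fun s : ℝ => Complex.exp (-1 * s)) (volume.restrict (Set.Ioi 0)) :=
    integrableOn_exp_mul_complex_Ioi (by simp) 0
  have hw := hw1.mul_prod hw2
  have hS : Measurable fun p : ℝ≥0 × ℝ => p.2.toNNReal / p.1 := by fun_prop
  refine ⟨.pushforward (ν.prod (volume.restrict (Set.Ioi 0))) (fun p => p.2.toNNReal / p.1) hw,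
    fun z hz => ?_⟩
  rw [FiniteComplexMeasure.laplace_pushforward _ hS hw hz.le, integral_prod]
  · refine integral_congr_ae (Eventually.of_forall fun τ => ?_)
    by_cases hτ : τ = 0
    · simp [hτ]
    · have hτ' : (0 : ℝ) < τ := by exact_mod_cast pos_iff_ne_zero.2 hτ
      have hτc : ((τ : ℝ) : ℂ) ≠ 0 := by exact_mod_cast hτ'.ne'
      have hre : (-(1 + z / ((τ : ℝ) : ℂ))).re < 0 := by
        rw [Complex.neg_re, Complex.add_re, Complex.div_ofReal_re, Complex.one_re]
        have := div_pos hz hτ'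
        linarith
      have h := integral_exp_mul_complex_Ioi hre 0
      simp only [Complex.ofReal_zero, mul_zero, Complex.exp_zero, neg_div_neg_eq] at h
      have h1 : (1 : ℂ) / (1 + z / ((τ : ℝ) : ℂ)) = ((τ : ℝ) : ℂ) / (z + ((τ : ℝ) : ℂ)) := by
        have := add_coe_ne_zero hz τ
        have h2 : 1 + z / ((τ : ℝ) : ℂ) = (z + ((τ : ℝ) : ℂ)) / ((τ : ℝ) : ℂ) := by
          field_simp
          ring
        rw [h2, one_div_div]
      beta_reduce
      rw [← h1, ← h]
      refine setIntegral_congr_fun measurableSet_Ioi fun s hs => ?_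
      simp only [if_neg hτ, one_mul]
      rw [← Complex.exp_add, NNReal.coe_div, Real.coe_toNNReal _ (le_of_lt hs)]
      congr 1
      push_cast
      field_simp
      ring
  · refine hw.norm.mono' (hw.aestronglyMeasurable.mul
      (by fun_prop : Measurable fun p : ℝ≥0 × ℝ =>
        Complex.exp (-(((p.2.toNNReal / p.1 : ℝ≥0) : ℝ) : ℂ) * z)).aestronglyMeasurable)
      (Eventually.of_forall fun p => ?_)
    rw [norm_mul]
    exact mul_le_of_le_one_right (norm_nonneg _)
      (FiniteComplexMeasure.norm_laplaceKernel_le hz.le _)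

/-- Isolates the singularity at 0 in the factor `(z+1)/z`: what remains is built from `(z+1)⁻¹` and
the transform of the exponential mixture. -/
lemma integral_stieltjesKernel_eq {z : ℂ} (hz : 0 < z.re) :
    ∫ τ : ℝ≥0, (1 + ((τ : ℝ) : ℂ)) / (z + ((τ : ℝ) : ℂ)) ∂ν =
      (z + 1) / z * (ν.real Set.univ * (z + 1)⁻¹ +
        (1 - 2 * (z + 1)⁻¹) * ∫ τ : ℝ≥0, ((τ : ℝ) : ℂ) / (z + ((τ : ℝ) : ℂ)) ∂ν) := by
  have hz0 : z ≠ 0 := fun h => by simp [h] at hz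
  have hz1 : z + 1 ≠ 0 := by simpa using add_coe_ne_zero hz 1
  have hp : Integrable (fun τ : ℝ≥0 => ((τ : ℝ) : ℂ) / (z + ((τ : ℝ) : ℂ))) ν := by
    refine (integrable_stieltjesKernel ν hz).mono (Continuous.aestronglyMeasurable
      (Continuous.div (by fun_prop) (by fun_prop) (add_coe_ne_zero hz)))
      (Eventually.of_forall fun τ => ?_)
    rw [norm_div, norm_div]
    gcongr
    rw [← Complex.ofReal_one, ← Complex.ofReal_add, Complex.norm_real, Complex.norm_real,
      Real.norm_of_nonneg τ.coe_nonneg, Real.norm_of_nonneg (by positivity)]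
    linarith
  have hm : (ν.real Set.univ : ℂ) * (z + 1)⁻¹ = ∫ _ : ℝ≥0, (z + 1)⁻¹ ∂ν := by
    rw [integral_const, Complex.real_smul]
  rw [hm, ← integral_const_mul, ← integral_add (integrable_const _) (hp.const_mul _),
    ← integral_const_mul]
  refine integral_congr_ae (Eventually.of_forall fun τ => ?_)
  have := add_coe_ne_zero hz τ
  simp only
  field_simp
  ring

end FiniteMeasure

/-- The definition gives the integral formula only on `(0, ∞)`. It extends to the half-plane by the
identity theorem, the right side being holomorphic because it is expressed through a Laplace
transform. -/
lemma IsStieltjes.exists_representation {f : ℂ → ℂ} (hf : IsStieltjes f) :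
    ∃ (a : ℝ) (ν : Measure ℝ≥0), 0 ≤ a ∧ IsFiniteMeasure ν ∧ ∀ z : ℂ, 0 < z.re →
      f z = a + ∫ τ : ℝ≥0, (1 + ((τ : ℝ) : ℂ)) / (z + ((τ : ℝ) : ℂ)) ∂ν := by
  obtain ⟨a, ν, ha, hν, hfx⟩ := hf.exists_finite_measure
  refine ⟨a, ν, ha, hν, ?_⟩
  obtain ⟨κ, hκ⟩ := exists_laplace_eq_integral ν
  have hopen : IsOpen {z : ℂ | 0 < z.re} := isOpen_lt continuous_const Complex.continuous_re
  have hconn : IsPreconnected {z : ℂ | 0 < z.re} := (convex_halfSpace_re_gt 0).isPreconnected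
  set g : ℂ → ℂ := fun z => a + (z + 1) / z * (ν.real Set.univ * (z + 1)⁻¹ +
    (1 - 2 * (z + 1)⁻¹) * κ.laplace z) with hg
  have hgd : DifferentiableOn ℂ g {z | 0 < z.re} := by
    have hz0 : ∀ z ∈ {z : ℂ | 0 < z.re}, z ≠ 0 := fun z hz h => by simp [h] at hz
    have hz1 : ∀ z ∈ {z : ℂ | 0 < z.re}, z + 1 ≠ 0 := fun z hz => by
      simpa using add_coe_ne_zero hz 1
    have hinv : DifferentiableOn ℂ (fun z : ℂ => (z + 1)⁻¹) {z | 0 < z.re} :=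
      DifferentiableOn.inv (by fun_prop) hz1
    exact (((differentiableOn_id.add_const 1).div differentiableOn_id hz0).mul
      ((hinv.const_mul _).add (((hinv.const_mul 2).const_sub 1).mul
        κ.differentiableOn_laplace))).const_add _
  have hgz : ∀ z : ℂ, 0 < z.re →
      g z = a + ∫ τ : ℝ≥0, (1 + ((τ : ℝ) : ℂ)) / (z + ((τ : ℝ) : ℂ)) ∂ν := fun z hz => by
    rw [integral_stieltjesKernel_eq ν hz, ← hκ z hz]
  have hfd : DifferentiableOn ℂ f {z | 0 < z.re} :=
    hf.1.mono fun z hz => Or.inl hz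
  have heq : ∀ x : ℝ, 0 < x → f x = g x := fun x hx => by
    rw [hgz x (by simpa using hx), hfx x hx]
    push_cast
    rw [← integral_complex_ofReal]
    push_cast
    rfl
  have hfreq : ∃ᶠ z in 𝓝[≠] (1 : ℂ), f z = g z := by
    have hlim : Tendsto (fun x : ℝ => (x : ℂ)) (𝓝[>] 1) (𝓝[≠] 1) := by
      refine tendsto_nhdsWithin_iff.2 ⟨?_, ?_⟩
      · simpa using (Complex.continuous_ofReal.tendsto 1).mono_left
          (nhdsWithin_le_nhds (s := Set.Ioi (1 : ℝ)))
      · filter_upwards [self_mem_nhdsWithin] with x hx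
        exact Complex.ofReal_ne_one.2 (ne_of_gt hx)
    refine hlim.frequently (Eventually.frequently ?_)
    filter_upwards [self_mem_nhdsWithin] with x hx
    exact heq x (zero_lt_one.trans hx)
  have := (hfd.analyticOnNhd hopen).eqOn_of_preconnected_of_frequently_eq
    (hgd.analyticOnNhd hopen) hconn (z₀ := 1) (by simp) hfreq
  exact fun z hz => (this hz).trans (hgz z hz)

lemma IsStieltjes.div_mul_mem_laplaceAlgebra {X : Type*} [NormedAddCommGroup X]
    [NormedSpace ℂ X] [CompleteSpace X] (T : BoundedC0Semigroup X) {f : ℂ → ℂ}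
    (hf : IsStieltjes f) :
    (fun z : {z : ℂ // 0 < z.re} => (z : ℂ) / (z + 1) * f z) ∈ T.laplaceAlgebra := by
  obtain ⟨a, ν, -, hν, hrep⟩ := hf.exists_representation
  obtain ⟨κ, hκ⟩ := exists_laplace_eq_integral ν
  have hr := T.inv_add_mem_laplaceAlgebra (l := 1) (by simp)
  have hP := T.mem_laplaceAlgebra_of_laplace (g := fun z => κ.laplace z) κ fun _ => rfl
  set r : {z : ℂ // 0 < z.re} → ℂ := fun z => ((z : ℂ) + 1)⁻¹ with hrdef
  set P : {z : ℂ // 0 < z.re} → ℂ := fun z => κ.laplace z with hPdef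
  have hmem : (a : ℂ) • (1 - r) + ((ν.real Set.univ : ℂ) • r + (1 - (2 : ℂ) • r) * P) ∈
      T.laplaceAlgebra :=
    add_mem (T.laplaceAlgebra.smul_mem (sub_mem (one_mem _) hr) _)
      (add_mem (T.laplaceAlgebra.smul_mem hr _)
        (mul_mem (sub_mem (one_mem _) (T.laplaceAlgebra.smul_mem hr _)) hP))
  convert hmem using 1
  funext z
  have hz0 := BoundedC0Semigroup.ne_zero_of_re_pos z
  have hz1 : (z : ℂ) + 1 ≠ 0 := by simpa using add_coe_ne_zero z.2 1
  simp only [Pi.add_apply, Pi.sub_apply, Pi.mul_apply, Pi.smul_apply, Pi.one_apply, smul_eq_mul,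
    hrdef, hPdef]
  rw [hrep z z.2, integral_stieltjesKernel_eq ν z.2, hκ z z.2]
  field_simp
  ring

/-- Rotate by `c = 1 ± i`, of modulus `√2`, with the sign of `Im z`. For `x = Re z + |Im z|` one has
`Re(c/(z+τ)) = (x+τ)/|z+τ|² ≥ 1/(x+τ)`, since `|z+τ| ≤ x+τ`. Integrate over `τ`. -/
lemma IsStieltjes.re_le_sqrt_two_mul_norm_of_re_pos {f : ℂ → ℂ} (hf : IsStieltjes f) {z : ℂ}
    (hz : 0 < z.re) : (f ((z.re + |z.im| : ℝ) : ℂ)).re ≤ √2 * ‖f z‖ := by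
  obtain ⟨a, ν, ha, hν, hrep⟩ := hf.exists_representation
  obtain ⟨σ, hσ, hσz⟩ : ∃ σ : ℝ, σ ^ 2 = 1 ∧ σ * z.im = |z.im| := by
    rcases le_total 0 z.im with h | h
    · exact ⟨1, by norm_num, by rw [abs_of_nonneg h, one_mul]⟩
    · exact ⟨-1, by norm_num, by rw [abs_of_nonpos h, neg_one_mul]⟩
  set x : ℝ := z.re + |z.im| with hx
  have hx0 : 0 < x := by positivity
  have hxre : 0 < (x : ℂ).re := by simpa using hx0
  set c : ℂ := 1 + σ * Complex.I with hc
  have hcnorm : ‖c‖ = √2 := by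
    rw [Complex.norm_def]
    congr 1
    simp [hc, Complex.normSq_apply, ← sq, hσ]
    norm_num
  have hkey : ∀ τ : ℝ≥0, ((1 + ((τ : ℝ) : ℂ)) / ((x : ℂ) + ((τ : ℝ) : ℂ))).re ≤
      (c * ((1 + ((τ : ℝ) : ℂ)) / (z + ((τ : ℝ) : ℂ)))).re := fun τ => by
    have hτ := τ.coe_nonneg
    have hpos : 0 < (z.re + τ) ^ 2 + z.im ^ 2 := by positivity
    have h1 : ((1 + ((τ : ℝ) : ℂ)) / ((x : ℂ) + ((τ : ℝ) : ℂ))).re = (1 + τ) / (x + τ) := by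
      rw [← Complex.ofReal_one, ← Complex.ofReal_add, ← Complex.ofReal_add, ← Complex.ofReal_div,
        Complex.ofReal_re]
    have h2 : (c * ((1 + ((τ : ℝ) : ℂ)) / (z + ((τ : ℝ) : ℂ)))).re =
        (1 + τ) * ((x + τ) / ((z.re + τ) ^ 2 + z.im ^ 2)) := by
      rw [← Complex.ofReal_one, ← Complex.ofReal_add, div_eq_mul_inv, mul_left_comm,
        Complex.re_ofReal_mul]
      congr 1
      simp [hc, Complex.inv_re, Complex.inv_im, Complex.normSq_apply, ← sq]
      rw [hx, ← hσz]
      ring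
    rw [h1, h2, div_eq_mul_inv]
    refine mul_le_mul_of_nonneg_left ?_ (by positivity)
    rw [le_div_iff₀ hpos, inv_mul_le_iff₀ (by positivity)]
    have h3 : z.im ^ 2 = |z.im| ^ 2 := (sq_abs _).symm
    have h4 := abs_nonneg z.im
    rw [h3, hx]
    nlinarith [mul_nonneg hz.le h4, mul_nonneg hτ h4]
  have hre : ∀ w : ℂ, 0 < w.re → ∀ d : ℂ,
      (d * ∫ τ : ℝ≥0, (1 + ((τ : ℝ) : ℂ)) / (w + ((τ : ℝ) : ℂ)) ∂ν).re =
      ∫ τ : ℝ≥0, (d * ((1 + ((τ : ℝ) : ℂ)) / (w + ((τ : ℝ) : ℂ)))).re ∂ν := fun w hw d => by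
    rw [← integral_const_mul]
    exact (integral_re ((integrable_stieltjesKernel ν hw).const_mul d)).symm
  calc (f (x : ℂ)).re = a + ∫ τ : ℝ≥0, ((1 + ((τ : ℝ) : ℂ)) / ((x : ℂ) + ((τ : ℝ) : ℂ))).re ∂ν := by
        have := hre x hxre 1
        simp only [one_mul] at this
        rw [hrep x hxre, Complex.add_re, Complex.ofReal_re, this]
    _ ≤ a + ∫ τ : ℝ≥0, (c * ((1 + ((τ : ℝ) : ℂ)) / (z + ((τ : ℝ) : ℂ)))).re ∂ν := by
        have hmono := integral_mono (integrable_stieltjesKernel ν hxre).re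
          ((integrable_stieltjesKernel ν hz).const_mul c).re hkey
        simp only [RCLike.re_to_complex] at hmono
        linarith
    _ = (c * f z).re := by
        rw [← hre z hz c, hrep z hz, mul_add, Complex.add_re (c * a)]
        congr 1
        simp [hc]
    _ ≤ ‖c * f z‖ := Complex.re_le_norm _
    _ = √2 * ‖f z‖ := by rw [norm_mul, hcnorm]

/-- Limit of the previous bound at `z = x + is`, `x → 0+`, by continuity on the slit plane. -/
lemma IsStieltjes.re_le_sqrt_two_mul_norm {f : ℂ → ℂ} (hf : IsStieltjes f) {s : ℝ} (hs : s ≠ 0) :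
    (f (|s| : ℝ)).re ≤ √2 * ‖f (Complex.I * s)‖ := by
  have h1 : Complex.I * s ∈ Complex.slitPlane := Or.inr (by simpa using hs)
  have h2 : ((|s| : ℝ) : ℂ) ∈ Complex.slitPlane := Or.inl (by simpa using hs)
  have hc1 := (hf.1.continuousOn.continuousAt (Complex.isOpen_slitPlane.mem_nhds h1)).tendsto
  have hc2 := (hf.1.continuousOn.continuousAt (Complex.isOpen_slitPlane.mem_nhds h2)).tendsto
  have l1 : Tendsto (fun x : ℝ => (x : ℂ) + Complex.I * s) (𝓝[>] 0) (𝓝 (Complex.I * s)) := by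
    have : Continuous fun x : ℝ => (x : ℂ) + Complex.I * s := by fun_prop
    simpa using (this.tendsto 0).mono_left (nhdsWithin_le_nhds (s := Set.Ioi (0 : ℝ)))
  have l2 : Tendsto (fun x : ℝ => ((x + |s| : ℝ) : ℂ)) (𝓝[>] 0) (𝓝 ((|s| : ℝ) : ℂ)) := by
    have : Continuous fun x : ℝ => ((x + |s| : ℝ) : ℂ) := by fun_prop
    simpa using (this.tendsto 0).mono_left (nhdsWithin_le_nhds (s := Set.Ioi (0 : ℝ)))
  refine le_of_tendsto_of_tendsto ((Complex.continuous_re.tendsto _).comp (hc2.comp l2))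
    ((hc1.comp l1).norm.const_mul _) ?_
  filter_upwards [self_mem_nhdsWithin] with x hx
  have := hf.re_le_sqrt_two_mul_norm_of_re_pos (z := x + Complex.I * s) (by simpa using hx)
  simpa using this

lemma IsStieltjes.im_ofReal {f : ℂ → ℂ} (hf : IsStieltjes f) {x : ℝ} (hx : 0 < x) :
    (f x).im = 0 := by
  obtain ⟨-, a, μ, -, -, hfx⟩ := hf
  rw [hfx x hx, Complex.ofReal_im]

lemma IsStieltjes.re_ofReal_nonneg {f : ℂ → ℂ} (hf : IsStieltjes f) {x : ℝ} (hx : 0 < x) :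
    0 ≤ (f x).re := by
  obtain ⟨-, a, μ, ha, -, hfx⟩ := hf
  rw [hfx x hx, Complex.ofReal_re]
  exact add_nonneg ha (integral_nonneg fun τ => inv_nonneg.2 (by positivity))

/-! ### Negative powers as Stieltjes functions -/

lemma isStieltjes_inv : IsStieltjes fun z => z⁻¹ := by
  refine ⟨differentiableOn_id.inv fun z hz => Complex.slitPlane_ne_zero hz, 0, Measure.dirac 0,
    le_rfl, integrable_dirac (by simp), fun x _ => ?_⟩
  simp

/-- `x^{-β} = c⁻¹ ∫₀^∞ t^{-β}/(x+t) dt`, obtained by dividing the integral representation of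
`x^{1-β}` by `x`. -/
lemma isStieltjes_cpow {β : ℝ} (h0 : 0 < β) (h1 : β < 1) :
    IsStieltjes fun z => z ^ (-(β : ℂ)) := by
  have hp : 1 - β ∈ Set.Ioo (0 : ℝ) 1 := ⟨by linarith, by linarith⟩
  set c := ∫ t in Set.Ioi (0 : ℝ), Real.rpowIntegrand₀₁ (1 - β) t 1 with hc
  have hc0 : 0 < c := Real.integral_rpowIntegrand₀₁_one_pos hp
  set g : ℝ → ENNReal := fun t => ENNReal.ofReal (c⁻¹ * t ^ (-β)) with hg
  have hgm : Measurable g := by fun_prop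
  have hgtop : ∀ᵐ t ∂(volume.restrict (Set.Ioi (0 : ℝ))), g t < ⊤ :=
    Eventually.of_forall fun _ => ENNReal.ofReal_lt_top
  have hφm : ∀ x : ℝ, Measurable fun τ : ℝ≥0 => (x + (τ : ℝ))⁻¹ := fun x => by fun_prop
  have heq : ∀ x : ℝ, 0 < x → Set.EqOn
      (fun t => (g t).toReal • (x + (t.toNNReal : ℝ))⁻¹)
      (fun t => (c⁻¹ * x⁻¹) * Real.rpowIntegrand₀₁ (1 - β) t x) (Set.Ioi 0) := fun x hx t ht => by
    have ht : 0 < t := ht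
    have hg0 : 0 ≤ c⁻¹ * t ^ (-β) := mul_nonneg (inv_nonneg.2 hc0.le) (Real.rpow_nonneg ht.le _)
    simp only [hg, ENNReal.toReal_ofReal hg0, Real.coe_toNNReal _ ht.le, smul_eq_mul]
    rw [Real.rpowIntegrand₀₁_eq_pow_div hp ht.le hx.le, show (1 - β - 1 : ℝ) = -β by ring]
    have : t + x ≠ 0 := by positivity
    have : x + t ≠ 0 := by positivity
    field_simp
    ring
  refine ⟨fun z hz => (differentiableAt_id.cpow_const hz).differentiableWithinAt, 0,
    ((volume.restrict (Set.Ioi (0 : ℝ))).withDensity g).map Real.toNNReal, le_rfl, ?_,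
    fun x hx => ?_⟩
  · rw [integrable_map_measure (hφm 1).aestronglyMeasurable measurable_real_toNNReal.aemeasurable,
      integrable_withDensity_iff_integrable_smul' hgm hgtop]
    exact IntegrableOn.congr_fun
      ((Real.integrableOn_rpowIntegrand₀₁_Ioi hp zero_le_one).const_mul _)
      (heq 1 one_pos).symm measurableSet_Ioi
  · rw [integral_map measurable_real_toNNReal.aemeasurable (hφm x).aestronglyMeasurable,
      integral_withDensity_eq_integral_toReal_smul hgm hgtop,
      setIntegral_congr_fun measurableSet_Ioi (heq x hx), integral_const_mul,
      Real.integral_rpowIntegrand₀₁_eq_rpow_mul_const hp hx.le, ← hc, zero_add,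
      ← Complex.ofReal_neg]
    beta_reduce
    rw [← Complex.ofReal_cpow hx.le]
    congr 1
    rw [Real.rpow_sub hx, Real.rpow_one, Real.rpow_neg hx.le]
    field_simp

/-! ### Operators in the extended calculus and lower bounds -/

lemma IsStieltjesProduct.continuousAt {f : ℂ → ℂ} (hf : IsStieltjesProduct f) {z : ℂ}
    (hz : z ∈ Complex.slitPlane) : ContinuousAt f z := by
  obtain ⟨f₁, f₂, h₁, h₂, hprod⟩ := hf
  have hnhds := Complex.isOpen_slitPlane.mem_nhds hz
  exact ((h₁.1.continuousOn.continuousAt hnhds).mul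
    (h₂.1.continuousOn.continuousAt hnhds)).congr (by
      filter_upwards [hnhds] with w hw using (hprod w hw).symm)

lemma IsStieltjesProduct.differentiableOn {f : ℂ → ℂ} (hf : IsStieltjesProduct f) :
    DifferentiableOn ℂ f {z | 0 < z.re} := by
  obtain ⟨f₁, f₂, h₁, h₂, hprod⟩ := hf
  have hsub : {z : ℂ | 0 < z.re} ⊆ Complex.slitPlane := fun z hz => Or.inl hz
  exact ((h₁.1.mul h₂.1).mono hsub).congr fun z hz => hprod z (hsub hz)

lemma IsStieltjesProduct.re_le_two_mul_norm {f : ℂ → ℂ} (hf : IsStieltjesProduct f) {s : ℝ}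
    (hs : s ≠ 0) : (f (|s| : ℝ)).re ≤ 2 * ‖f (Complex.I * s)‖ := by
  obtain ⟨f₁, f₂, h₁, h₂, hprod⟩ := hf
  have hs' : 0 < |s| := abs_pos.2 hs
  rw [hprod _ (Or.inl (by simpa using hs)), hprod _ (Or.inr (by simpa using hs)), Complex.mul_re,
    h₁.im_ofReal hs', zero_mul, sub_zero, norm_mul]
  calc _ ≤ (√2 * ‖f₁ (Complex.I * s)‖) * (√2 * ‖f₂ (Complex.I * s)‖) :=
        mul_le_mul (h₁.re_le_sqrt_two_mul_norm hs) (h₂.re_le_sqrt_two_mul_norm hs)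
          (h₂.re_ofReal_nonneg hs') (by positivity)
    _ = (√2 * √2) * (‖f₁ (Complex.I * s)‖ * ‖f₂ (Complex.I * s)‖) := by ring
    _ = _ := by rw [Real.mul_self_sqrt (by norm_num)]

/-- The power `z^{-α}`, `0 < α ≤ 2`, is a product of two Stieltjes functions. -/
lemma isStieltjesProduct_cpow {α : ℝ} (h0 : 0 < α) (h2 : α ≤ 2) :
    IsStieltjesProduct fun z => z ^ (-(α : ℂ)) := by
  have hS : IsStieltjes fun z => z ^ (-((α / 2 : ℝ) : ℂ)) := by
    -- At `α = 2` each factor is `z⁻¹`, represented by a point mass at 0 instead of the power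
    -- density.
    rcases eq_or_lt_of_le h2 with rfl | h2
    · simpa [Complex.cpow_neg_one] using isStieltjes_inv
    · exact isStieltjes_cpow (by linarith) (by linarith)
  refine ⟨_, _, hS, hS, fun z hz => ?_⟩
  beta_reduce
  rw [← Complex.cpow_add _ _ (Complex.slitPlane_ne_zero hz)]
  congr 1
  push_cast
  ring

/-- The exponential has modulus 1 on the imaginary axis. At this `s`, `|1 + (t/n)is|² = 1 + 1/n`,
whose `n`-th power is at least 2 by Bernoulli. -/
lemma one_sub_inv_sqrt_two_le_norm_scalarEulerError {n : ℕ} {t : ℝ≥0} (hn : 0 < n) (ht : 0 < t)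
    {s : ℝ} (hs : |s| = √(n : ℝ) / (t : ℝ)) :
    1 - 1 / √2 ≤ ‖BoundedC0Semigroup.scalarEulerError n t (Complex.I * s)‖ := by
  have hn' : (0 : ℝ) < n := by exact_mod_cast hn
  have ht' : (0 : ℝ) < t := by exact_mod_cast ht
  set w : ℂ := 1 + (((t : ℝ) / (n : ℝ) : ℝ) : ℂ) * (Complex.I * s) with hw
  have hexp : ‖Complex.exp (-((t : ℝ) : ℂ) * (Complex.I * s))‖ = 1 := by
    rw [Complex.norm_exp]
    simp
  have hwsq : ‖w‖ ^ 2 = 1 + (n : ℝ)⁻¹ := by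
    have hs2 : s ^ 2 = n / (t : ℝ) ^ 2 := by
      rw [← sq_abs, hs, div_pow, Real.sq_sqrt hn'.le]
    rw [Complex.sq_norm, Complex.normSq_apply]
    simp [hw, -Complex.ofReal_div]
    calc _ = ((t : ℝ) / n) ^ 2 * s ^ 2 := by ring
      _ = _ := by
        rw [hs2]
        field_simp
  have hpow : 2 ≤ (‖w‖ ^ n) ^ 2 := by
    rw [← pow_mul, mul_comm, pow_mul, hwsq]
    have := one_add_mul_le_pow (a := (n : ℝ)⁻¹) (by linarith [inv_pos.2 hn']) n
    rw [mul_inv_cancel₀ hn'.ne'] at this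
    linarith
  have hsqrt : √2 ≤ ‖w‖ ^ n := Real.sqrt_le_iff.2 ⟨by positivity, hpow⟩
  have h1 : ‖(w⁻¹) ^ n‖ ≤ 1 / √2 := by
    rw [norm_pow, norm_inv, inv_pow, ← one_div]
    gcongr
  calc 1 - 1 / √2 ≤ ‖Complex.exp (-((t : ℝ) : ℂ) * (Complex.I * s))‖ - ‖(w⁻¹) ^ n‖ := by
        rw [hexp]
        linarith
    _ ≤ _ := norm_sub_norm_le _ _
    _ = _ := norm_sub_rev _ _

section Calculus

variable {X : Type*} [NormedAddCommGroup X] [NormedSpace ℂ X] [CompleteSpace X]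

namespace BoundedC0Semigroup

variable {T : BoundedC0Semigroup X} {A : X →ₗ.[ℂ] X}

lemma continuousOn_scalarEulerError (n : ℕ) (t : ℝ≥0) :
    ContinuousOn (scalarEulerError n t) {z | 0 ≤ z.re} := by
  refine ContinuousOn.sub ((ContinuousOn.inv₀ (by fun_prop) fun z hz h => ?_).pow n) (by fun_prop)
  have hz : 0 ≤ z.re := hz
  have := congrArg Complex.re h
  simp [-Complex.ofReal_div] at this
  have : 0 ≤ (t : ℝ) / n * z.re := by positivity
  linarith

omit [CompleteSpace X] in
lemma eqBounded_invMul {U V D B : X →L[ℂ] X} (hU : Function.Injective U) (h : V * D = U * B) :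
    EqBounded (mulBounded (invMul U V hU) D) B := by
  have hVD : ∀ x, V (D x) = U (B x) := fun x => congrArg (fun W : X →L[ℂ] X => W x) h
  refine LinearPMap.ext ?_ ?_
  · refine eq_top_iff.2 fun x _ => ?_
    exact ⟨B x, (hVD x).symm⟩
  · intro x hx _
    change (LinearEquiv.ofInjective U.toLinearMap hU).symm _ = B x
    rw [LinearEquiv.symm_apply_eq]
    exact Subtype.ext (hVD x)

/-- `calculus` uses an unspecified regularizer; this retains only what holds for any choice. -/
lemma exists_mem_calculusGraph_of_regularizable {f : ℂ → ℂ} (hf : T.Regularizable f) :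
    ∃ (e : {z : ℂ // 0 < z.re} → ℂ) (U V : X →L[ℂ] X) (hU : Function.Injective U),
      (e, U) ∈ T.calculusGraph ∧
        (fun z : {z : ℂ // 0 < z.re} => e z * f z, V) ∈ T.calculusGraph ∧
        T.calculus f = invMul U V hU := by
  have hreg := hf.2.choose_spec.choose_spec
  refine ⟨fun z => hf.2.choose.laplace z, T.hillePhillips hf.2.choose,
    T.hillePhillips hf.2.choose_spec.choose, hreg.1, ⟨_, fun _ => rfl, rfl⟩,
    ⟨_, fun z => (hreg.2 z z.2).symm, rfl⟩, ?_⟩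
  rw [calculus, dif_pos hf]

/-- If `f g` is a Laplace transform, then `f(A) g(A)` is the corresponding bounded operator. -/
lemma eqBounded_mulBounded_calculus {f : ℂ → ℂ} (hf : T.Regularizable f)
    {g : {z : ℂ // 0 < z.re} → ℂ} {D B : X →L[ℂ] X} (hD : (g, D) ∈ T.calculusGraph)
    (hB : (fun z : {z : ℂ // 0 < z.re} => f z * g z, B) ∈ T.calculusGraph) :
    EqBounded (mulBounded (T.calculus f) D) B := by
  obtain ⟨e, U, V, hU, hUe, hVe, hcalc⟩ := exists_mem_calculusGraph_of_regularizable hf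
  rw [hcalc]
  -- Both `V * D` and `U * B` have symbol `e f g`.
  refine eqBounded_invMul hU (T.calculusGraph_unique (mul_mem hVe hD) ?_)
  convert mul_mem hUe hB using 1
  refine Prod.ext (funext fun z => ?_) rfl
  exact mul_assoc (e z) (f z) (g z)

lemma sq_div_mul_mem_laplaceAlgebra (T : BoundedC0Semigroup X) {f : ℂ → ℂ}
    (hf : IsStieltjesProduct f) :
    (fun z : {z : ℂ // 0 < z.re} => ((z : ℂ) / (z + 1)) ^ 2 * f z) ∈ T.laplaceAlgebra := by
  obtain ⟨f₁, f₂, h₁, h₂, hprod⟩ := hf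
  convert mul_mem (h₁.div_mul_mem_laplaceAlgebra T) (h₂.div_mul_mem_laplaceAlgebra T) using 1
  funext z
  rw [Pi.mul_apply, hprod z (Or.inl z.2)]
  ring

/-- The regularizer is `(1 - (z+1)⁻¹)² = (z/(z+1))²`. Its operator is injective since `1 - (1+A)⁻¹ =
A(1+A)⁻¹` and `A` is injective. -/
lemma regularizable_of_isStieltjesProduct (hA : T.IsGenerator (-A))
    (hran : Dense (Set.range A)) {f : ℂ → ℂ} (hf : IsStieltjesProduct f) :
    T.Regularizable f := by
  have hl : 0 < (1 : ℂ).re := by simp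
  have he := pow_mem (sub_mem (one_mem _) (T.resolvent_mem_calculusGraph hl)) 2
  obtain ⟨μ, hμ, hμe⟩ := he
  obtain ⟨V, ν, hν, -⟩ := T.mem_laplaceAlgebra_iff.1
    (sq_div_mul_mem_laplaceAlgebra T hf)
  have hinj : ∀ x, x - T.resolvent hl x = 0 → x = 0 := fun x hx => by
    obtain ⟨hdom, hAx⟩ := exists_apply_resolvent hA hl x
    rw [one_smul, hx] at hAx
    have := injective_of_dense_range hA hran _ hAx
    rw [sub_eq_zero] at hx
    rw [hx]
    exact this
  refine ⟨hf.differentiableOn, μ, ν, ?_, fun z hz => ?_⟩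
  · rw [hμe]
    refine (injective_iff_map_eq_zero _).2 fun x hx => hinj x (hinj _ ?_)
    simpa [sq] using hx
  · have h1 := hμ ⟨z, hz⟩
    have h2 := hν ⟨z, hz⟩
    rw [h1, h2]
    have : z + 1 ≠ 0 := by simpa using add_coe_ne_zero hz 1
    simp only [Prod.pow_fst, Prod.fst_sub, Prod.fst_one, Pi.pow_apply, Pi.sub_apply, Pi.one_apply]
    congr 2
    field_simp
    ring

/-- The double zero of the Euler error pays for one factor `(z+1)/z` per Stieltjes function. -/
lemma mul_scalarEulerError_mem_laplaceAlgebra (T : BoundedC0Semigroup X) {f : ℂ → ℂ}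
    (hf : IsStieltjesProduct f) {n : ℕ} {t : ℝ≥0} (hn : 0 < n) (ht : 0 < t) :
    (fun z : {z : ℂ // 0 < z.re} => f z * scalarEulerError n t z) ∈ T.laplaceAlgebra := by
  convert mul_mem (sq_div_mul_mem_laplaceAlgebra T hf)
    (T.scalarEulerError_mul_mem_laplaceAlgebra hn ht) using 1
  funext z
  have h0 := ne_zero_of_re_pos z
  have h1 : (z : ℂ) + 1 ≠ 0 := by simpa using add_coe_ne_zero z.2 1
  simp only [Pi.mul_apply]
  field_simp

/-- Spectral inclusion, for functions that are continuous up to a point of the imaginary axis. -/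
lemma norm_le_of_mem_calculusGraph (hA : T.IsGenerator (-A)) {s : ℝ}
    (hs : Complex.I * s ∈ spectrum A) {g : ℂ → ℂ}
    (hg : ContinuousWithinAt g {z | 0 ≤ z.re} (Complex.I * s)) {B : X →L[ℂ] X}
    (hB : (fun z : {z : ℂ // 0 < z.re} => g z, B) ∈ T.calculusGraph) :
    ‖g (Complex.I * s)‖ ≤ ‖B‖ := by
  obtain ⟨ν, hν, hνB⟩ := hB
  have hν : ∀ z : {z : ℂ // 0 < z.re}, ν.laplace z = g z := hν
  have hνB : T.hillePhillips ν = B := hνB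
  have hlim : Tendsto (fun ε : ℝ => Complex.I * s + ε) (𝓝[>] 0)
      (𝓝[{z | 0 ≤ z.re}] (Complex.I * s)) := by
    refine tendsto_nhdsWithin_iff.2 ⟨?_, ?_⟩
    · have : Continuous fun ε : ℝ => Complex.I * s + ε := by fun_prop
      simpa using (this.tendsto 0).mono_left (nhdsWithin_le_nhds (s := Set.Ioi (0 : ℝ)))
    · filter_upwards [self_mem_nhdsWithin] with ε hε
      simpa using le_of_lt hε
  -- The symbol identity is known only for `Re z > 0`; both sides are continuous up to the point
  -- `is`.
  have heq : ν.laplace (Complex.I * s) = g (Complex.I * s) := by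
    refine tendsto_nhds_unique ((ν.continuousOn_laplace _ (by simp)).tendsto.comp hlim)
      ((hg.tendsto.comp hlim).congr' ?_)
    filter_upwards [self_mem_nhdsWithin] with ε hε
    exact (hν ⟨Complex.I * s + ε, by simpa using hε⟩).symm
  rw [← heq, ← hνB]
  exact norm_laplace_le_norm_hillePhillips hA hs ν

lemma exists_eqBounded_eulerError (hA : T.IsGenerator (-A)) (hran : Dense (Set.range A))
    (hspec : {r : ℝ | ∃ s : ℝ, Complex.I * (s : ℂ) ∈ spectrum A ∧ |s| = r} = Set.Ici 0)
    {f : ℂ → ℂ} (hf : IsStieltjesProduct f) {n : ℕ} {t : ℝ≥0} (hn : 0 < n) (ht : 0 < t) :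
    ∃ B : X →L[ℂ] X, EqBounded (mulBounded (T.calculus f) (eulerError T A n t)) B ∧
      1 / 2 * (1 - 1 / √2) * (f ((√(n : ℝ) / (t : ℝ) : ℝ) : ℂ)).re ≤ ‖B‖ := by
  obtain ⟨B, hB⟩ := T.mem_laplaceAlgebra_iff.1 (mul_scalarEulerError_mem_laplaceAlgebra T hf hn ht)
  refine ⟨B, eqBounded_mulBounded_calculus (regularizable_of_isStieltjesProduct hA hran hf)
    (T.eulerError_mem_calculusGraph hA hn ht) hB, ?_⟩
  have hpos : 0 < √(n : ℝ) / (t : ℝ) :=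
    div_pos (Real.sqrt_pos.2 (by exact_mod_cast hn)) (by exact_mod_cast ht)
  -- The spectral hypothesis gives `is` or its reflection, with no control of the sign; the scalar
  -- bounds involve only `|s|`.
  obtain ⟨s, hs, hsr⟩ : √(n : ℝ) / (t : ℝ) ∈
      {r : ℝ | ∃ s : ℝ, Complex.I * (s : ℂ) ∈ spectrum A ∧ |s| = r} := by
    rw [hspec]
    exact hpos.le
  have hs0 : s ≠ 0 := by
    rintro rfl
    rw [abs_zero] at hsr
    exact hpos.ne hsr
  have hslit : Complex.I * s ∈ Complex.slitPlane := Or.inr (by simpa using hs0)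
  have hle := norm_le_of_mem_calculusGraph hA hs (g := fun z => f z * scalarEulerError n t z)
    ((hf.continuousAt hslit).continuousWithinAt.mul
      (continuousOn_scalarEulerError n t _ (by simp))) hB
  refine le_trans ?_ hle
  have h1 := hf.re_le_two_mul_norm hs0
  have h2 := one_sub_inv_sqrt_two_le_norm_scalarEulerError hn ht hsr
  have h3 : 0 ≤ 1 - 1 / √2 := by
    rw [sub_nonneg, div_le_one (by positivity)]
    exact Real.one_le_sqrt.2 (by norm_num)
  rw [hsr] at h1
  rw [norm_mul]
  calc 1 / 2 * (1 - 1 / √2) * (f ((√(n : ℝ) / (t : ℝ) : ℝ) : ℂ)).re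
      ≤ 1 / 2 * (1 - 1 / √2) * (2 * ‖f (Complex.I * s)‖) := by gcongr
    _ = ‖f (Complex.I * s)‖ * (1 - 1 / √2) := by ring
    _ ≤ _ := by gcongr

end BoundedC0Semigroup

end Calculus

end EulerRates

theorem theorem6p3 {X : Type*} [NormedAddCommGroup X] [NormedSpace ℂ X] [CompleteSpace X]
    (T : EulerRates.BoundedC0Semigroup X) (A : X →ₗ.[ℂ] X)
    (hA : T.IsGenerator (-A))
    (hran : Dense (Set.range A))
    (hspec : {r : ℝ | ∃ s : ℝ, Complex.I * (s : ℂ) ∈ EulerRates.spectrum A ∧ |s| = r} =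
      Set.Ici 0) :
    (∀ f : ℂ → ℂ, EulerRates.IsStieltjesProduct f → T.Regularizable f ∧
      ∀ (n : ℕ) (t : ℝ≥0), 0 < n → 0 < t →
        ∃ B : X →L[ℂ] X,
          EulerRates.EqBounded
            (EulerRates.mulBounded (T.calculus f) (EulerRates.eulerError T A n t)) B ∧
          1 / 2 * (1 - 1 / √2) * (f ((√(n : ℝ) / (t : ℝ) : ℝ) : ℂ)).re ≤ ‖B‖) ∧
    (∀ α : ℝ, 0 < α → α ≤ 2 → T.Regularizable (fun z => z ^ (-(α : ℂ))) ∧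
      ∀ (n : ℕ) (t : ℝ≥0), 0 < n → 0 < t →
        ∃ B : X →L[ℂ] X,
          EulerRates.EqBounded
            (EulerRates.mulBounded (T.calculus fun z => z ^ (-(α : ℂ)))
              (EulerRates.eulerError T A n t)) B ∧
          1 / 2 * (1 - 1 / √2) * ((t : ℝ) / √(n : ℝ)) ^ α ≤ ‖B‖) := by
  refine ⟨fun f hf => ⟨EulerRates.BoundedC0Semigroup.regularizable_of_isStieltjesProduct hA hran hf,
    fun n t hn ht => EulerRates.BoundedC0Semigroup.exists_eqBounded_eulerError hA hran hspec hf
      hn ht⟩, fun α h0 h2 => ?_⟩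
  have hf := EulerRates.isStieltjesProduct_cpow h0 h2
  refine ⟨EulerRates.BoundedC0Semigroup.regularizable_of_isStieltjesProduct hA hran hf,
    fun n t hn ht => ?_⟩
  obtain ⟨B, hB, hle⟩ :=
    EulerRates.BoundedC0Semigroup.exists_eqBounded_eulerError hA hran hspec hf hn ht
  refine ⟨B, hB, le_of_eq_of_le ?_ hle⟩
  have hnonneg : 0 ≤ √(n : ℝ) / (t : ℝ) := by positivity
  rw [← Complex.ofReal_neg, ← Complex.ofReal_cpow hnonneg, Complex.ofReal_re,
    Real.rpow_neg hnonneg, ← Real.inv_rpow hnonneg, inv_div]
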